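/- Let $\mathcal S,\mathcal X_1,\mathcal X_2,\mathcal Y_2,\mathcal Y_3$ be finite sets, $Q_S$ a probability distribution on $\mathcal S$ and $W_{Y_2,Y_3|X_1,X_2,S}$ a conditional probability distribution. Consider the discrete memoryless state-dependent relay channel $W_{Y_2,Y_3|X_1,X_2,S}$ with states $S_1,S_2,\dots$ i.i.d. $\sim Q_S$, known non-causally to the source only. An $(M,n)$ code consists of a source encoder $\phi_1:\{1,\dots,M\}\times\mathcal S^n\to\mathcal X_1^n$, relay encoders $\phi_{2,i}:\mathcal Y_2^{i-1}\to\mathcal X_2$ for $1\le i\le n$, and a decoder $\psi:\mathcal Y_3^n\to\{1,\dots,M\}$. With a message $w$ uniform on $\{1,\dots,M\}$, the joint probability of $(w,s^n,y_2^n,y_3^n)$ is $$\frac1M\prod_{i=1}^n Q_S(s_i)\,W\big(y_{2,i},y_{3,i}\,\big|\,\phi_1(w,s^n)_i,\ \phi_{2,i}(y_2^{i-1}),\ s_i\big),$$ and the average probability of error is the probability that $\psi(y_3^n)\ne w$. A rate $R\ge0$ (in bits) is achievable if there are $\epsilon_n\to0$ and, for every $n$, a $(\lceil 2^{nR}\rceil,n)$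 code with average probability of error at most $\epsilon_n$; the capacity $\mathcal C$ is the supremum of the achievable rates. Theorem. $\mathcal C\ge R^{\mathrm{lo}}$, where $$R^{\mathrm{lo}}=\sup\ \big\{I(U;Y_3)-I(U;S)\big\}$$ subject to the constraint $$I(X;\hat X)<I(U_R;Y_2)-I(U_R;S)-I(U_R;U|S),$$ the supremum being over all finite alphabets $\mathcal U,\mathcal U_R,\mathcal X$ and all joint distributions of $(S,U,U_R,X_1,X_2,X,\hat X,Y_2,Y_3)$ on $\mathcal S\times\mathcal U\times\mathcal U_R\times\mathcal X_1\times\mathcal X_2\times\mathcal X\times\mathcal X_2\times\mathcal Y_2\times\mathcal Y_3$ of the form $$Q_S\,P_{U,U_R|S}\,P_{X_1|U,U_R,S}\,P_{X|U,S}\,P_{\hat X|X}\,\mathbf 1_{X_2=\hat X}\,W_{Y_2,Y_3|X_1,X_2,S}.$$ All information quantities are in bits, and the supremum of the empty set is $-\infty$. -/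

import Mathlib

open Finset Filter Topology

/-! ### Information measures on a finite probability space (logarithms to base 2) -/

section Information

variable {Ω A B C : Type*} [Fintype Ω] [Fintype A] [Fintype B] [Fintype C]

open Classical in
/-- The law `P(f = a)` of the random variable `f` under the mass function `p`. -/
noncomputable def lawOf (p : Ω → ℝ) (f : Ω → A) (a : A) : ℝ :=
  ∑ ω, if f ω = a then p ω else 0

/-- The mutual information `I(f; g)` in bits, under the mass function `p`. -/
noncomputable def mutualInfo (p : Ω → ℝ) (f : Ω → A) (g : Ω → B) : ℝ :=
  ∑ a, ∑ b, lawOf p (fun ω => (f ω, g ω)) (a, b) *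
    Real.logb 2 (lawOf p (fun ω => (f ω, g ω)) (a, b) / (lawOf p f a * lawOf p g b))

/-- The conditional mutual information `I(f; g | h)` in bits, under the mass function `p`. -/
noncomputable def condMutualInfo (p : Ω → ℝ) (f : Ω → A) (g : Ω → B) (h : Ω → C) : ℝ :=
  ∑ a, ∑ b, ∑ c, lawOf p (fun ω => (f ω, g ω, h ω)) (a, b, c) *
    Real.logb 2 (lawOf p (fun ω => (f ω, g ω, h ω)) (a, b, c) * lawOf p h c /
      (lawOf p (fun ω => (f ω, h ω)) (a, c) * lawOf p (fun ω => (g ω, h ω)) (b, c)))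

end Information

/-! ### The state-dependent relay channel with informed source -/

/-- An `(M, n)` code: the source knows the message and the whole state sequence, the relay input at
time `i` depends on the relay outputs at the times before `i`, the destination decodes from its
output sequence. -/
structure RelayCode (S X₁ X₂ Y₂ Y₃ : Type*) (M n : ℕ) where
  /-- encoding function of the source -/
  source : Fin M → (Fin n → S) → (Fin n → X₁)
  /-- encoding functions of the relay -/
  relay : (i : Fin n) → (Fin (i : ℕ) → Y₂) → X₂
  /-- decoding function of the destination -/
  decode : (Fin n → Y₃) → Fin M

section Channel

variable {S X₁ X₂ Y₂ Y₃ : Type*} [Fintype S] [Fintype Y₂] [Fintype Y₃]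

/-- The joint probability, under a code, of the message `w` (uniform), the states `s`, the relay
outputs `y₂` and the destination outputs `y₃`; the channel inputs are determined by these. -/
noncomputable def RelayCode.prob {M n : ℕ} (Q : stdSimplex ℝ S)
    (W : X₁ → X₂ → S → stdSimplex ℝ (Y₂ × Y₃)) (c : RelayCode S X₁ X₂ Y₂ Y₃ M n)
    (w : Fin M) (s : Fin n → S) (y₂ : Fin n → Y₂) (y₃ : Fin n → Y₃) : ℝ :=
  (1 / (M : ℝ)) * ∏ i : Fin n,
    (Q.1 (s i) *
      (W (c.source w s i) (c.relay i (fun j => y₂ (Fin.castLE i.isLt.le j))) (s i)).1 (y₂ i, y₃ i))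

open Classical in
/-- The average probability of error of a code. -/
noncomputable def RelayCode.errorProb {M n : ℕ} (Q : stdSimplex ℝ S)
    (W : X₁ → X₂ → S → stdSimplex ℝ (Y₂ × Y₃)) (c : RelayCode S X₁ X₂ Y₂ Y₃ M n) : ℝ :=
  ∑ w : Fin M, ∑ s : Fin n → S, ∑ y₂ : Fin n → Y₂, ∑ y₃ : Fin n → Y₃,
    if c.decode y₃ ≠ w then c.prob Q W w s y₂ y₃ else 0

/-- `R` (in bits per channel use) is achievable: for some `ε n → 0` there are codes of every
length `n` with `⌈2 ^ (n R)⌉` messages and average probability of error at most `ε n`. -/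
def IsAchievable (Q : stdSimplex ℝ S) (W : X₁ → X₂ → S → stdSimplex ℝ (Y₂ × Y₃)) (R : ℝ) : Prop :=
  0 ≤ R ∧ ∃ ε : ℕ → ℝ, Tendsto ε atTop (𝓝 0) ∧
    ∀ n : ℕ, ∃ c : RelayCode S X₁ X₂ Y₂ Y₃ ⌈(2 : ℝ) ^ ((n : ℝ) * R)⌉₊ n, c.errorProb Q W ≤ ε n

/-- The capacity: the supremum of the achievable rates, taken in the extended reals. -/
noncomputable def capacity (Q : stdSimplex ℝ S)
    (W : X₁ → X₂ → S → stdSimplex ℝ (Y₂ × Y₃)) : EReal :=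
  sSup ((fun R : ℝ => (R : EReal)) '' {R : ℝ | IsAchievable Q W R})

end Channel

/-! ### Analog input description -/

/-- The factors of the joint measure that can be chosen; `X̂` takes its values in the relay input
alphabet, since `X₂ = X̂`. -/
structure AnalogInput (S U UR X₁ X₂ X : Type*)
    [Fintype U] [Fintype UR] [Fintype X₁] [Fintype X₂] [Fintype X] where
  /-- `P_{U,U_R|S}` -/
  pU : S → stdSimplex ℝ (U × UR)
  /-- `P_{X₁|U,U_R,S}` -/
  pX₁ : U → UR → S → stdSimplex ℝ X₁
  /-- `P_{X|U,S}` -/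
  pX : U → S → stdSimplex ℝ X
  /-- `P_{X̂|X}` -/
  pXhat : X → stdSimplex ℝ X₂

/-- The values of `(S, U, U_R, X₁, X₂, X, X̂, Y₂, Y₃)`. -/
abbrev AnalogOutcome (S U UR X₁ X₂ X Y₂ Y₃ : Type*) : Type _ :=
  S × U × UR × X₁ × X₂ × X × X₂ × Y₂ × Y₃

namespace AnalogInput

variable {S U UR X₁ X₂ X Y₂ Y₃ : Type*} [Fintype S] [Fintype U] [Fintype UR] [Fintype X₁]
  [Fintype X₂] [Fintype X] [Fintype Y₂] [Fintype Y₃]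

open Classical in
/-- The joint mass function
`Q_S P_{U,U_R|S} P_{X₁|U,U_R,S} P_{X|U,S} P_{X̂|X} 1_{X₂ = X̂} W_{Y₂,Y₃|X₁,X₂,S}`. -/
noncomputable def law (P : AnalogInput S U UR X₁ X₂ X) (Q : stdSimplex ℝ S)
    (W : X₁ → X₂ → S → stdSimplex ℝ (Y₂ × Y₃)) : AnalogOutcome S U UR X₁ X₂ X Y₂ Y₃ → ℝ :=
  fun (s, u, ur, x₁, x₂, x, xhat, y₂, y₃) =>
    Q.1 s * (P.pU s).1 (u, ur) * (P.pX₁ u ur s).1 x₁ * (P.pX u s).1 x * (P.pXhat x).1 xhat *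
      (if x₂ = xhat then 1 else 0) * (W x₁ x₂ s).1 (y₂, y₃)

/-- The random variable `S`. -/
def rvS : AnalogOutcome S U UR X₁ X₂ X Y₂ Y₃ → S := fun (s, _, _, _, _, _, _, _, _) => s
/-- The random variable `U`. -/
def rvU : AnalogOutcome S U UR X₁ X₂ X Y₂ Y₃ → U := fun (_, u, _, _, _, _, _, _, _) => u
/-- The random variable `U_R`. -/
def rvUR : AnalogOutcome S U UR X₁ X₂ X Y₂ Y₃ → UR := fun (_, _, ur, _, _, _, _, _, _) => ur
/-- The random variable `X`. -/
def rvX : AnalogOutcome S U UR X₁ X₂ X Y₂ Y₃ → X := fun (_, _, _, _, _, x, _, _, _) => x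
/-- The random variable `X̂`. -/
def rvXhat : AnalogOutcome S U UR X₁ X₂ X Y₂ Y₃ → X₂ := fun (_, _, _, _, _, _, xhat, _, _) => xhat
/-- The random variable `Y₂`. -/
def rvY₂ : AnalogOutcome S U UR X₁ X₂ X Y₂ Y₃ → Y₂ := fun (_, _, _, _, _, _, _, y₂, _) => y₂
/-- The random variable `Y₃`. -/
def rvY₃ : AnalogOutcome S U UR X₁ X₂ X Y₂ Y₃ → Y₃ := fun (_, _, _, _, _, _, _, _, y₃) => y₃

/-- The constraint `I(X; X̂) < I(U_R; Y₂) - I(U_R; S) - I(U_R; U | S)`. -/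
def Feasible (P : AnalogInput S U UR X₁ X₂ X) (Q : stdSimplex ℝ S)
    (W : X₁ → X₂ → S → stdSimplex ℝ (Y₂ × Y₃)) : Prop :=
  mutualInfo (P.law Q W) rvX rvXhat <
    mutualInfo (P.law Q W) rvUR rvY₂ - mutualInfo (P.law Q W) rvUR rvS
      - condMutualInfo (P.law Q W) rvUR rvU rvS

/-- The rate `I(U; Y₃) - I(U; S)`. -/
noncomputable def rate (P : AnalogInput S U UR X₁ X₂ X) (Q : stdSimplex ℝ S)
    (W : X₁ → X₂ → S → stdSimplex ℝ (Y₂ × Y₃)) : ℝ :=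
  mutualInfo (P.law Q W) rvU rvY₃ - mutualInfo (P.law Q W) rvU rvS

end AnalogInput

/-- The rate of analog input description: the supremum of `I(U; Y₃) - I(U; S)` over all finite
auxiliary alphabets and all joint measures that satisfy the constraint. -/
noncomputable def analogInputRate {S X₁ X₂ Y₂ Y₃ : Type*} [Fintype S] [Fintype X₁] [Fintype X₂]
    [Fintype Y₂] [Fintype Y₃] (Q : stdSimplex ℝ S)
    (W : X₁ → X₂ → S → stdSimplex ℝ (Y₂ × Y₃)) : EReal :=
  sSup {r : EReal | ∃ (U UR X : Type) (_ : Fintype U) (_ : Fintype UR) (_ : Fintype X)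
    (P : AnalogInput S U UR X₁ X₂ X), P.Feasible Q W ∧ r = ((P.rate Q W : ℝ) : EReal)}

/-! The scheme is block Markov coding, assembled backwards in time. Since the source knows all
states in advance, it can compute before a block starts which relay input suits it, describe that
input by an index, and convey the index to the relay through `U_R` during the preceding block, while
`U` carries a message to the destination. The index of a block is a function of the message and the
states of that block only, not of the index sent during it. Hence there is no circularity, and
blocks can be put one by one in front of a code already built (`HasIndexedCode.cons`).

A block works at message rate `ρ` and index rate `σ` if `ρ < I(U;Y₃) - I(U;S)`, `σ > I(X₂;U,S)` (the
index describes the relay input) and `σ < I(U_R;Y₂) - I(U_R;U,S)` (the index reaches the relay).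
Because `X₂` and `(U,S)` are independent given `X`, `I(X₂;U,S) ≤ I(X;X̂)`, and the strict constraint
leaves room for `σ`; see `AnalogInput.description_le` and `AnalogInput.Feasible.lt`.

No typical sequences are used. Encoder and decoder select from their respective distributions by
races between the same exponential clocks, and two such selections agree with a probability that has
a simple lower bound (`exists_matching`). Three such matchings give the one-shot theorem
`BlockKernels.exists_block_code`. Applied to sequences, its error bound is an expectation under a
product law, and a Chernoff argument (`tendsto_sum_mismatch`) shows that it vanishes.

It remains to give the relay the index of the first informative block. If the source could not
influence the relay output for any relay input and any state of positive probability, data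
processing would contradict the constraint (`InputKernels.exists_relayOutput_ne`). So a positive
rate to the relay is available with a frozen relay input (`exists_start_code`). The starting phase
is a fixed multiple of the block length, and its cost is spread over many blocks in
`isAchievable_of_blockCodes`. -/

/-! ### Indicators as real numbers. -/

section Indicator

open Classical in
/-- The indicator of a proposition. -/
noncomputable def ind (c : Prop) : ℝ := if c then 1 else 0

theorem ind_of {c : Prop} (h : c) : ind c = 1 := if_pos h

theorem ind_of_not {c : Prop} (h : ¬ c) : ind c = 0 := if_neg h

theorem ind_nonneg (c : Prop) : 0 ≤ ind c := by unfold ind; split_ifs <;> norm_num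

theorem ind_le_one (c : Prop) : ind c ≤ 1 := by unfold ind; split_ifs <;> norm_num

theorem ind_mono {c d : Prop} (h : c → d) : ind c ≤ ind d := by
  by_cases hc : c
  · rw [ind_of hc, ind_of (h hc)]
  · rw [ind_of_not hc]; exact ind_nonneg d

theorem ind_or_le (c d : Prop) : ind (c ∨ d) ≤ ind c + ind d := by
  by_cases hc : c
  · rw [ind_of (Or.inl hc), ind_of hc]; linarith [ind_nonneg d]
  · simp only [hc, false_or]; linarith [ind_nonneg False, ind_nonneg c, ind_nonneg d]

theorem ind_and (c d : Prop) : ind (c ∧ d) = ind c * ind d := by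
  by_cases hc : c <;> by_cases hd : d <;> simp [ind, hc, hd]

theorem sum_ind_eq {A : Type*} [Fintype A] (b : A) : ∑ a, ind (b = a) = 1 := by
  classical
  simp [ind]

end Indicator

/-! ### Exponential races and the matching of selections. -/

section Race
open MeasureTheory

/-- The exponential distribution of rate one. -/
noncomputable def unitExp : Measure ℝ :=
  (volume.restrict (Set.Ioi 0)).withDensity fun t => ENNReal.ofReal (Real.exp (-t))

theorem lintegral_exp_neg_mul_Ioi {c : ℝ} (hc : 0 < c) (x : ℝ) :
    ∫⁻ t in Set.Ioi x, ENNReal.ofReal (Real.exp (-(c * t))) =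
      ENNReal.ofReal (Real.exp (-(c * x)) / c) := by
  have hint : IntegrableOn (fun t => Real.exp (-(c * t))) (Set.Ioi x) := by
    simpa [neg_mul] using exp_neg_integrableOn_Ioi x hc
  rw [← ofReal_integral_eq_lintegral_ofReal hint (ae_of_all _ fun t => (Real.exp_pos _).le)]
  have := integral_exp_mul_Ioi (a := -c) (by linarith) x
  simp only [neg_mul] at this
  rw [this]
  congr 1
  field_simp

theorem unitExp_Ioi {x : ℝ} (hx : 0 ≤ x) :
    unitExp (Set.Ioi x) = ENNReal.ofReal (Real.exp (-x)) := by
  rw [unitExp, withDensity_apply _ measurableSet_Ioi, Measure.restrict_restrict measurableSet_Ioi,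
    Set.inter_eq_left.2 (Set.Ioi_subset_Ioi hx)]
  simpa using lintegral_exp_neg_mul_Ioi one_pos x

instance : IsProbabilityMeasure unitExp := by
  constructor
  rw [unitExp, withDensity_apply _ MeasurableSet.univ, Measure.restrict_univ]
  simpa using lintegral_exp_neg_mul_Ioi one_pos 0

theorem lintegral_unitExp_exp_neg_mul {c : ℝ} (hc : 0 ≤ c) :
    ∫⁻ t, ENNReal.ofReal (Real.exp (-(c * t))) ∂unitExp = ENNReal.ofReal (1 / (1 + c)) := by
  rw [unitExp, lintegral_withDensity_eq_lintegral_mul _ (by fun_prop) (by fun_prop)]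
  have h : ∀ t : ℝ, ENNReal.ofReal (Real.exp (-t)) * ENNReal.ofReal (Real.exp (-(c * t))) =
      ENNReal.ofReal (Real.exp (-((1 + c) * t))) := fun t => by
    rw [← ENNReal.ofReal_mul (Real.exp_pos _).le, ← Real.exp_add]
    congr 2; ring
  simp only [Pi.mul_apply, h]
  simpa using lintegral_exp_neg_mul_Ioi (c := 1 + c) (by linarith) 0

theorem ae_unitExp_pos : ∀ᵐ t ∂unitExp, 0 < t := by
  refine (withDensity_absolutelyContinuous _ _).ae_le ?_
  exact ae_restrict_mem measurableSet_Ioi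

variable {A : Type*} [Fintype A]

theorem lintegral_pi_unitExp_eval (a : A) {f g : ℝ → ENNReal} (hg : Measurable g)
    (h : f =ᵐ[unitExp] g) :
    ∫⁻ x, f (x a) ∂(Measure.pi fun _ : A => unitExp) = ∫⁻ t, g t ∂unitExp := by
  have hev := measurePreserving_eval (fun _ : A => unitExp) a
  rw [← hev.lintegral_comp hg]
  exact lintegral_congr_ae (hev.quasiMeasurePreserving.ae h)

/-- The probability that `a` wins a race between exponential clocks, the clock of `b` being slowed
down by `m b`. -/
theorem pi_unitExp_race (a : A) (m : A → ℝ) (hm : ∀ b, 0 ≤ m b) (hma : m a = 1) :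
    (Measure.pi fun _ : A => unitExp) {T | ∀ b, b ≠ a → m b * T a < T b} =
      ENNReal.ofReal (1 / ∑ b, m b) := by
  classical
  have hmp := measurePreserving_piEquivPiSubtypeProd (fun _ : A => unitExp) (fun b => b = a)
  set E : Set (({b // b = a} → ℝ) × ({b // ¬ b = a} → ℝ)) :=
    {z | ∀ b, m b.1 * z.1 ⟨a, rfl⟩ < z.2 b} with hE
  have hEm : MeasurableSet E := by
    rw [hE, Set.ofPred_forall]
    refine MeasurableSet.iInter fun b => measurableSet_lt ?_ ?_ <;> fun_prop
  have hpre : {T : A → ℝ | ∀ b, b ≠ a → m b * T a < T b} =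
      (MeasurableEquiv.piEquivPiSubtypeProd (fun _ : A => ℝ) (fun b => b = a)) ⁻¹' E := by
    ext T
    simp [hE, MeasurableEquiv.piEquivPiSubtypeProd, Equiv.piEquivPiSubtypeProd]
  rw [hpre, hmp.measure_preimage hEm.nullMeasurableSet, Measure.prod_apply hEm]
  set c : ℝ := ∑ b : {b // ¬ b = a}, m b with hc
  have hc0 : 0 ≤ c := Finset.sum_nonneg fun b _ => hm _
  have hsum : ∑ b, m b = 1 + c := by
    rw [hc, Fintype.sum_eq_add_sum_subtype_ne m a, hma]
  set g : ℝ → ENNReal := fun t =>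
    (Measure.pi fun _ : {b // ¬ b = a} => unitExp) (Set.univ.pi fun b => Set.Ioi (m b.1 * t)) with hg
  have h1 : ∀ x : {b // b = a} → ℝ, (Measure.pi fun _ : {b // ¬ b = a} => unitExp)
      (Prod.mk x ⁻¹' E) = g (x ⟨a, rfl⟩) := fun x => by
    rw [hg]
    congr 1
    ext z
    simp [hE]
  simp only [h1]
  -- Given that the clock of `a` rings at `t`, the other clocks independently outlast `m b * t`, so
  -- the survival probabilities multiply to `exp (-c t)`.
  have h2 : ∀ᵐ t ∂unitExp, g t = ENNReal.ofReal (Real.exp (-(c * t))) := by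
    filter_upwards [ae_unitExp_pos] with t ht
    rw [hg]
    simp only [Measure.pi_pi]
    rw [Finset.prod_congr rfl fun b _ => unitExp_Ioi (mul_nonneg (hm b.1) ht.le),
      ← ENNReal.ofReal_prod_of_nonneg fun b _ => (Real.exp_pos _).le, ← Real.exp_sum,
      hc, Finset.sum_mul, Finset.sum_neg_distrib]
  refine (@lintegral_pi_unitExp_eval {b // b = a} (Subtype.fintype fun b => b = a) ⟨a, rfl⟩ _ _ (by fun_prop) h2).trans ?_
  rw [lintegral_unitExp_exp_neg_mul hc0, hsum]


/-- `a` wins the race between exponential clocks with rates `p`. -/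
def raceWin {A : Type*} (p : A → ℝ) (a : A) : Set (A → ℝ) :=
  {T | 0 < p a ∧ ∀ b, b ≠ a → p b * T a < p a * T b}

theorem raceWin_unique {A : Type*} {p : A → ℝ} {a b : A} {T : A → ℝ} (ha : T ∈ raceWin p a)
    (hb : T ∈ raceWin p b) : a = b := by
  by_contra h
  exact lt_asymm (ha.2 b (Ne.symm h)) (hb.2 a h)

theorem measurableSet_raceWin {A : Type*} [Countable A] (p : A → ℝ) (a : A) : MeasurableSet (raceWin p a) := by
  have : raceWin p a = {_T : A → ℝ | 0 < p a} ∩ ⋂ b, ⋂ (_ : b ≠ a),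
      {T : A → ℝ | p b * T a < p a * T b} := by
    ext T; simp [raceWin]
  rw [this]
  refine (MeasurableSet.const _).inter (MeasurableSet.iInter fun b => MeasurableSet.iInter fun _ =>
    measurableSet_lt ?_ ?_) <;> fun_prop

theorem pi_unitExp_raceWin (P : stdSimplex ℝ A) (a : A) :
    (Measure.pi fun _ : A => unitExp).real (raceWin P.1 a) = P.1 a := by
  rcases (P.2.1 a).eq_or_lt with h | h
  · have : raceWin P.1 a = ∅ := by
      ext T; simp [raceWin, ← h]
    simp [this, ← h]
  · have : raceWin P.1 a = {T | ∀ b, b ≠ a → P.1 b / P.1 a * T a < T b} := by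
      ext T
      simp only [raceWin, Set.mem_ofPred_eq, h, true_and]
      refine forall₂_congr fun b _ => ?_
      rw [div_mul_eq_mul_div, div_lt_iff₀ h, mul_comm (T b)]
    rw [this, measureReal_def, pi_unitExp_race a _ (fun b => div_nonneg (P.2.1 b) h.le)
      (div_self h.ne'), ← Finset.sum_div, P.2.2, one_div_one_div, ENNReal.toReal_ofReal h.le]

/-- The bound on the conditional probability that two races with the same clocks have different
winners, in terms of the probabilities of the first winner. -/
noncomputable def mismatch (p q : ℝ) : ℝ := p * (1 - q) / (q + p * (1 - q))

/-- Winning both races amounts to winning a single race with slowdowns `max (P b / P a) (Q b / Q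
a)`. For `b ≠ a` the maximum is at most the sum of the two ratios, so the total slowdown is at most
`1 / P a + (1 - Q a) / Q a`, and the reciprocal of this is the left side. -/
theorem le_pi_unitExp_raceWin_inter (P Q : stdSimplex ℝ A) (a : A) :
    P.1 a - P.1 a * mismatch (P.1 a) (Q.1 a) ≤
      (Measure.pi fun _ : A => unitExp).real (raceWin P.1 a ∩ raceWin Q.1 a) := by
  have hQ1 : Q.1 a ≤ 1 := by
    rw [← Q.2.2]; exact Finset.single_le_sum (fun b _ => Q.2.1 b) (mem_univ a)
  have hP1 : P.1 a ≤ 1 := by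
    rw [← P.2.2]; exact Finset.single_le_sum (fun b _ => P.2.1 b) (mem_univ a)
  rcases (P.2.1 a).eq_or_lt with hp | hp
  · rw [← hp]; simp
  rcases (Q.2.1 a).eq_or_lt with hq | hq
  · rw [mismatch, ← hq]
    simp [hp.ne']
  set m : A → ℝ := fun b => max (P.1 b / P.1 a) (Q.1 b / Q.1 a) with hm
  have hset : raceWin P.1 a ∩ raceWin Q.1 a ⊇
      {T | 0 < T a} ∩ {T | ∀ b, b ≠ a → m b * T a < T b} := by
    rintro T ⟨hT, h⟩
    have hT : 0 < T a := hT
    constructor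
    · refine ⟨hp, fun b hb => ?_⟩
      have := (mul_le_mul_of_nonneg_right (le_max_left _ _) hT.le).trans_lt (h b hb)
      rwa [div_mul_eq_mul_div, div_lt_iff₀ hp, mul_comm (T b)] at this
    · refine ⟨hq, fun b hb => ?_⟩
      have := (mul_le_mul_of_nonneg_right (le_max_right _ _) hT.le).trans_lt (h b hb)
      rwa [div_mul_eq_mul_div, div_lt_iff₀ hq, mul_comm (T b)] at this
  have hpos : ∀ᵐ T ∂(Measure.pi fun _ : A => unitExp), T ∈ {T : A → ℝ | 0 < T a} :=
    (measurePreserving_eval (fun _ : A => unitExp) a).quasiMeasurePreserving.ae ae_unitExp_pos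
  refine le_trans ?_ (measureReal_mono hset)
  rw [measureReal_def, Measure.measure_inter_eq_of_ae hpos,
    pi_unitExp_race a m (fun b => le_max_of_le_left (div_nonneg (P.2.1 b) hp.le))
      (by simp [hm, hp.ne', hq.ne']), ENNReal.toReal_ofReal (by
        refine one_div_nonneg.2 (Finset.sum_nonneg fun b _ =>
          le_max_of_le_left (div_nonneg (P.2.1 b) hp.le)))]
  have hsum : ∑ b, m b ≤ 1 / P.1 a + (1 - Q.1 a) / Q.1 a := by
    classical
    have h1 : ∀ b, m b ≤ P.1 b / P.1 a + if b = a then 0 else Q.1 b / Q.1 a := fun b => by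
      split_ifs with hb
      · subst hb; simp [hm, hp.ne', hq.ne']
      · exact max_le (le_add_of_nonneg_right (div_nonneg (Q.2.1 b) hq.le))
          (le_add_of_nonneg_left (div_nonneg (P.2.1 b) hp.le))
    refine (Finset.sum_le_sum fun b _ => h1 b).trans ?_
    rw [Finset.sum_add_distrib, ← Finset.sum_div, P.2.2]
    have h2 : ∑ b, (if b = a then 0 else Q.1 b / Q.1 a) = (1 - Q.1 a) / Q.1 a := by
      rw [sub_div, ← Q.2.2, Finset.sum_div, Fintype.sum_eq_add_sum_subtype_ne _ a,
        Fintype.sum_eq_add_sum_subtype_ne (fun b => Q.1 b / Q.1 a) a]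
      simp only [if_true, zero_add, add_sub_cancel_left]
      exact Finset.sum_congr rfl fun b _ => if_neg b.2
    rw [h2]
  have hmpos : 0 < ∑ b, m b := by
    refine lt_of_lt_of_le one_pos ?_
    have : m a = 1 := by simp [hm, hp.ne', hq.ne']
    rw [← this]
    exact Finset.single_le_sum (f := m)
      (fun b _ => le_max_of_le_left (div_nonneg (P.2.1 b) hp.le)) (mem_univ a)
  refine le_trans (le_of_eq ?_) (one_div_le_one_div_of_le hmpos hsum)
  have hd : Q.1 a + P.1 a * (1 - Q.1 a) ≠ 0 :=
    (add_pos_of_pos_of_nonneg hq (mul_nonneg hp.le (by linarith))).ne'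
  rw [mismatch, div_add_div _ _ hp.ne' hq.ne']
  field_simp
  ring

/-- Selections from families of distributions on `A` by races between common clocks: if `a` is
selected from `P i`, then it is unlikely that something else is selected from `Q j`, unless
`(P i) a` is large compared with `(Q j) a`. -/
theorem exists_matching {I J : Type*} [Fintype I] [Fintype J] (P : I → stdSimplex ℝ A)
    (Q : J → stdSimplex ℝ A) [Nonempty A] :
    ∃ (k : ℕ) (p : stdSimplex ℝ (Fin k)) (f : Fin k → I → A) (g : Fin k → J → A),
      (∀ i a, ∑ x, p.1 x * ind (f x i = a) = (P i).1 a) ∧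
      ∀ i j a, ∑ x, p.1 x * ind (f x i = a ∧ g x j ≠ a) ≤
        (P i).1 a * mismatch ((P i).1 a) ((Q j).1 a) := by
  classical
  set μ := Measure.pi fun _ : A => unitExp with hμ
  let _ : MeasurableSpace A := ⊤
  have hsel : ∀ R : stdSimplex ℝ A, ∃ σ : (A → ℝ) → A, Measurable σ ∧
      ∀ a, raceWin R.1 a ⊆ σ ⁻¹' {a} := by
    intro R
    -- The arbitrary value is taken only when no clock wins strictly.
    refine ⟨fun T => if h : ∃ a, T ∈ raceWin R.1 a then h.choose else Classical.arbitrary A, ?_, ?_⟩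
    · refine measurable_to_countable' fun a => ?_
      have : (fun T => if h : ∃ a, T ∈ raceWin R.1 a then h.choose else Classical.arbitrary A) ⁻¹'
          {a} = raceWin R.1 a ∪ ((⋃ b, raceWin R.1 b)ᶜ ∩ {_T | Classical.arbitrary A = a}) := by
        ext T
        by_cases h : ∃ b, T ∈ raceWin R.1 b
        · have h' := h
          obtain ⟨b, hb⟩ := h'
          have hc : h.choose = b := raceWin_unique h.choose_spec hb
          have : T ∈ ⋃ b, raceWin R.1 b := Set.mem_iUnion.2 h
          simp only [Set.mem_preimage, h, dif_pos, hc, Set.mem_singleton_iff, Set.mem_union,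
            Set.mem_inter_iff, Set.mem_compl_iff, this, not_true, false_and, or_false]
          exact ⟨fun e => e ▸ hb, fun e => raceWin_unique hb e⟩
        · have h2 : ∀ b, T ∉ raceWin R.1 b := fun b hb => h ⟨b, hb⟩
          simp [h2]
      rw [this]
      exact (measurableSet_raceWin _ _).union
        ((MeasurableSet.iUnion fun b => measurableSet_raceWin _ _).compl.inter (.const _))
    · intro a T hT
      have h : ∃ a, T ∈ raceWin R.1 a := ⟨a, hT⟩
      simp only [Set.mem_preimage, h, dif_pos, Set.mem_singleton_iff]
      exact raceWin_unique h.choose_spec hT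
  choose σ hσm hσ using hsel
  have hlaw : ∀ (R : stdSimplex ℝ A) a, μ.real (σ R ⁻¹' {a}) = R.1 a := by
    intro R
    -- Each fibre has at least the desired mass and both families sum to one, so equality holds
    -- everywhere; ties need no separate treatment.
    have hle : ∀ a, R.1 a ≤ μ.real (σ R ⁻¹' {a}) := fun a => by
      rw [← pi_unitExp_raceWin R a]; exact measureReal_mono (hσ R a)
    have hs : ∑ a, μ.real (σ R ⁻¹' {a}) = ∑ a, R.1 a := by
      rw [sum_measureReal_preimage_singleton _ fun a _ => hσm R (measurableSet_singleton a), R.2.2]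
      simp
    intro a
    exact (((Finset.sum_eq_sum_iff_of_le fun a _ => hle a).1 hs.symm) a (mem_univ a)).symm
  -- Only the pair of selection functions matters, and it takes finitely many values. Pushing the
  -- law of the clocks forward along `F` makes the common randomness finite.
  set F : (A → ℝ) → (I → A) × (J → A) := fun T => (fun i => σ (P i) T, fun j => σ (Q j) T) with hF
  have hFm : Measurable F := (measurable_pi_lambda _ fun i => hσm _).prodMk
    (measurable_pi_lambda _ fun j => hσm _)
  let e := Fintype.equivFin ((I → A) × (J → A))
  have hfib : ∀ x, MeasurableSet (F ⁻¹' {x}) := fun x => hFm (measurableSet_singleton x)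
  have hsum : ∀ (S : Finset ((I → A) × (J → A))),
      ∑ k, (if e.symm k ∈ S then μ.real (F ⁻¹' {e.symm k}) else 0) = μ.real (F ⁻¹' S) := by
    intro S
    rw [e.symm.sum_comp fun x => if x ∈ S then μ.real (F ⁻¹' {x}) else 0, ← Finset.sum_filter,
      Finset.filter_mem_eq_inter, Finset.univ_inter,
      sum_measureReal_preimage_singleton S fun x _ => hfib x]
  refine ⟨_, ⟨fun k => μ.real (F ⁻¹' {e.symm k}), fun k => measureReal_nonneg, ?_⟩,
    fun k => (e.symm k).1, fun k => (e.symm k).2, fun i a => ?_, fun i j a => ?_⟩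
  · simpa using hsum univ
  · have := hsum {x | x.1 i = a}
    simp only [mem_filter, mem_univ, true_and] at this
    simp only [ind, mul_ite, mul_one, mul_zero]
    rw [← hlaw (P i) a]
    convert this using 2
    ext T
    simp [hF]
  · have := hsum {x | x.1 i = a ∧ x.2 j ≠ a}
    simp only [mem_filter, mem_univ, true_and] at this
    simp only [ind, mul_ite, mul_one, mul_zero]
    have h2 : μ.real (F ⁻¹' ({x | x.1 i = a ∧ x.2 j ≠ a} : Finset ((I → A) × (J → A)))) =
        (P i).1 a - μ.real (σ (P i) ⁻¹' {a} ∩ σ (Q j) ⁻¹' {a}) := by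
      rw [eq_sub_iff_add_eq, ← hlaw (P i) a,
        ← measureReal_inter_add_sdiff (s := σ (P i) ⁻¹' {a}) (hσm (Q j) (measurableSet_singleton a)),
        add_comm]
      congr 2
      ext T
      simp [hF]
    have h3 := (le_pi_unitExp_raceWin_inter (P i) (Q j) a).trans
      (measureReal_mono (Set.inter_subset_inter (hσ (P i) a) (hσ (Q j) a)))
    refine le_trans (le_of_eq ?_) (show (P i).1 a - μ.real (σ (P i) ⁻¹' {a} ∩ σ (Q j) ⁻¹' {a}) ≤ _ by
      linarith)
    rw [← h2, ← this]
end Race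

/-! ### Finite distributions. -/

section Simplex

variable {A B : Type*} [Fintype A] [Fintype B]

theorem nonempty_of_stdSimplex (p : stdSimplex ℝ A) : Nonempty A := by
  by_contra h
  rw [not_nonempty_iff] at h
  simpa using p.2.2

theorem stdSimplex_le_one (p : stdSimplex ℝ A) (a : A) : p.1 a ≤ 1 := by
  rw [← p.2.2]
  exact Finset.single_le_sum (fun b _ => p.2.1 b) (mem_univ a)

/-- The product of two distributions. -/
def prodSimplex (p : stdSimplex ℝ A) (q : stdSimplex ℝ B) : stdSimplex ℝ (A × B) :=
  ⟨fun x => p.1 x.1 * q.1 x.2, fun x => mul_nonneg (p.2.1 _) (q.2.1 _), by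
    rw [Fintype.sum_prod_type, ← Finset.sum_mul_sum, p.2.2, q.2.2, one_mul]⟩

/-- The point mass. -/
noncomputable def pointSimplex (a : A) : stdSimplex ℝ A :=
  ⟨fun b => ind (a = b), fun _ => ind_nonneg _, sum_ind_eq a⟩

/-- The uniform distribution. -/
noncomputable def uniformSimplex (A : Type*) [Fintype A] [Nonempty A] : stdSimplex ℝ A :=
  ⟨fun _ => 1 / (Fintype.card A : ℝ), fun _ => by positivity, by
    simp⟩

/-- This is the derandomization step of random coding, used for the codebooks, for the source input
and for the choice of a message subset. -/
theorem exists_le_weighted_sum (p : stdSimplex ℝ A) (F : A → ℝ) : ∃ a, F a ≤ ∑ b, p.1 b * F b := by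
  by_contra! h
  obtain ⟨a⟩ := nonempty_of_stdSimplex p
  have h1 : ∑ b, p.1 b * (∑ c, p.1 c * F c) < ∑ b, p.1 b * F b := by
    refine Finset.sum_lt_sum (fun b _ => mul_le_mul_of_nonneg_left (h b).le (p.2.1 b)) ?_
    obtain ⟨b, -, hb⟩ := Finset.exists_ne_zero_of_sum_ne_zero (p.2.2.trans_ne one_ne_zero)
    exact ⟨b, mem_univ b, mul_lt_mul_of_pos_left (h b) ((p.2.1 b).lt_of_ne' hb)⟩
  rw [← Finset.sum_mul, p.2.2, one_mul] at h1
  exact lt_irrefl _ h1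

theorem sum_prod_three {C : Type*} [Fintype C] (a : A → ℝ) (b : B → ℝ) (c : C → ℝ) :
    ∑ x : A × B × C, a x.1 * b x.2.1 * c x.2.2 = (∑ x, a x) * (∑ x, b x) * ∑ x, c x := by
  simp only [Fintype.sum_prod_type, mul_assoc, ← Finset.mul_sum, ← Finset.sum_mul]

end Simplex

/-! ### Matching with a message or an index. -/

section Matching

variable {A I J : Type*} [Fintype A] [Fintype I] [Fintype J]

theorem sum_ind_and_eq_zero {k : ℕ} {p : stdSimplex ℝ (Fin k)} {c d : Fin k → Prop}
    (h : ∑ x, p.1 x * ind (c x) = 0) : ∑ x, p.1 x * ind (c x ∧ d x) = 0 := by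
  refine le_antisymm ?_ (Finset.sum_nonneg fun x _ => mul_nonneg (p.2.1 x) (ind_nonneg _))
  rw [← h]
  exact Finset.sum_le_sum fun x _ => mul_le_mul_of_nonneg_left (ind_mono And.left) (p.2.1 x)

theorem ind_fst_eq {A M : Type*} [Fintype M] (z : A × M) (a : A) (c : Prop) :
    ind (z.1 = a ∧ c) = ∑ w, ind (z = (a, w) ∧ c) := by
  obtain ⟨b, v⟩ := z
  simp only [ind_and, Prod.mk.injEq, ← Finset.mul_sum, ← Finset.sum_mul, sum_ind_eq, mul_one]

/-- Matching for the transmission of a message: the selection from `P i` is made by a party that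
knows the message, the selection from `Q j` by one that has to find out the message. -/
theorem exists_matching_message {M : Type*} [Fintype M] [Nonempty M] [Nonempty A]
    (P : I → stdSimplex ℝ A) (Q : J → stdSimplex ℝ A) :
    ∃ (k : ℕ) (p : stdSimplex ℝ (Fin k)) (f : Fin k → I → M → A) (g : Fin k → J → A × M),
      (∀ i w a, ∑ x, p.1 x * ind (f x i w = a) = (P i).1 a) ∧
      ∀ i w j a, ∑ x, p.1 x * ind (f x i w = a ∧ g x j ≠ (a, w)) ≤
        (P i).1 a * mismatch ((P i).1 a) ((Q j).1 a / Fintype.card M) := by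
  classical
  -- Knowing the message is modelled by a point mass, not knowing it by the uniform law; the latter
  -- puts the factor `1 / card M` into the mismatch.
  obtain ⟨k, p, f, g, h1, h2⟩ := exists_matching
    (fun iw : I × M => prodSimplex (P iw.1) (pointSimplex iw.2))
    (fun j => prodSimplex (Q j) (uniformSimplex M))
  have hz : ∀ i w v a, v ≠ w → ∑ x, p.1 x * ind (f x (i, w) = (a, v)) = 0 := fun i w v a hv => by
    rw [h1]
    simp [prodSimplex, pointSimplex, ind_of_not (Ne.symm hv)]
  refine ⟨k, p, fun x i w => (f x (i, w)).1, g, fun i w a => ?_, fun i w j a => ?_⟩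
  · have : ∀ x, ind ((f x (i, w)).1 = a) = ∑ v, ind (f x (i, w) = (a, v)) := fun x => by
      simpa using ind_fst_eq (f x (i, w)) a True
    simp only [this, Finset.mul_sum]
    rw [Finset.sum_comm, Finset.sum_eq_single w (fun v _ hv => hz i w v a hv) (by simp), h1]
    simp [prodSimplex, pointSimplex, ind_of]
  · simp only [ind_fst_eq, Finset.mul_sum]
    rw [Finset.sum_comm, Finset.sum_eq_single w
      (fun v _ hv => sum_ind_and_eq_zero (hz i w v a hv)) (by simp)]
    have := h2 (i, w) j (a, w)
    simpa [prodSimplex, pointSimplex, uniformSimplex, ind_of, div_eq_mul_inv] using this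

/-- Matching for the description of a selection from `P i` by an index. -/
theorem exists_matching_index {T : Type*} [Fintype T] [Nonempty T] [Nonempty A]
    (P : I → stdSimplex ℝ A) (q : stdSimplex ℝ A) :
    ∃ (k : ℕ) (p : stdSimplex ℝ (Fin k)) (f : Fin k → I → A × T) (g : Fin k → T → A),
      (∀ i a t, ∑ x, p.1 x * ind (f x i = (a, t)) = (P i).1 a / Fintype.card T) ∧
      ∀ i a t, ∑ x, p.1 x * ind (f x i = (a, t) ∧ g x t ≠ a) ≤
        (P i).1 a / Fintype.card T * mismatch ((P i).1 a / Fintype.card T) (q.1 a) := by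
  classical
  -- Here the selecting party draws the index uniformly along with `a`, and the other party knows
  -- the index and has to recover `a`.
  obtain ⟨k, p, f, g, h1, h2⟩ := exists_matching
    (fun i => prodSimplex (P i) (uniformSimplex T))
    (fun t : T => prodSimplex q (pointSimplex t))
  refine ⟨k, p, f, fun x t => (g x t).1, fun i a t => ?_, fun i a t => ?_⟩
  · rw [h1]
    simp [prodSimplex, uniformSimplex, div_eq_mul_inv]
  · have := h2 i t (a, t)
    simp only [prodSimplex, pointSimplex, uniformSimplex, ind_of, mul_one, mul_one_div] at this
    refine le_trans (Finset.sum_le_sum fun x _ => mul_le_mul_of_nonneg_left (ind_mono ?_) (p.2.1 x))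
      this
    rintro ⟨h, h'⟩
    exact ⟨h, fun e => h' (congrArg Prod.fst e)⟩

end Matching

/-! ### One-shot coding theorem for a single block. -/

/-- The distributions that govern the transmission of one block: the states `Q`, the channel `W`,
the auxiliary variables and inputs `pU`, `pR`, `p₁`, `p₂`. -/
structure InputKernels (S U R X₁ X₂ Y₂ Y₃ : Type*) [Fintype S] [Fintype U] [Fintype R]
    [Fintype X₁] [Fintype X₂] [Fintype Y₂] [Fintype Y₃] where
  /-- law of the state -/
  Q : stdSimplex ℝ S
  /-- the channel -/
  W : X₁ → X₂ → S → stdSimplex ℝ (Y₂ × Y₃)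
  /-- auxiliary variable decoded by the destination -/
  pU : S → stdSimplex ℝ U
  /-- auxiliary variable decoded by the relay -/
  pR : U → S → stdSimplex ℝ R
  /-- source input -/
  p₁ : U → R → S → stdSimplex ℝ X₁
  /-- relay input -/
  p₂ : U → S → stdSimplex ℝ X₂

/-- Input distributions together with the distributions `q₃`, `q₂`, `qx` by which the destination
and the relay decode. -/
structure BlockKernels (S U R X₁ X₂ Y₂ Y₃ : Type*) [Fintype S] [Fintype U] [Fintype R]
    [Fintype X₁] [Fintype X₂] [Fintype Y₂] [Fintype Y₃] extends
    InputKernels S U R X₁ X₂ Y₂ Y₃ where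
  /-- decoding metric of the destination -/
  q₃ : Y₃ → stdSimplex ℝ U
  /-- decoding metric of the relay -/
  q₂ : Y₂ → stdSimplex ℝ R
  /-- codeword distribution of the relay -/
  qx : stdSimplex ℝ X₂

/-- The joint law of state, auxiliary variables, inputs and outputs. -/
def InputKernels.law {S U R X₁ X₂ Y₂ Y₃ : Type*} [Fintype S] [Fintype U] [Fintype R]
    [Fintype X₁] [Fintype X₂] [Fintype Y₂] [Fintype Y₃] (K : InputKernels S U R X₁ X₂ Y₂ Y₃) :
    S × U × R × X₁ × X₂ × (Y₂ × Y₃) → ℝ :=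
  fun (s, u, r, x₁, x₂, y) => K.Q.1 s * (K.pU s).1 u * (K.pR u s).1 r * (K.p₁ u r s).1 x₁ *
    (K.p₂ u s).1 x₂ * (K.W x₁ x₂ s).1 y

namespace BlockKernels

variable {S U R X₁ X₂ Y₂ Y₃ : Type*} [Fintype S] [Fintype U] [Fintype R]
    [Fintype X₁] [Fintype X₂] [Fintype Y₂] [Fintype Y₃]

/-- The bound on the conditional error probability of a block code with `m` messages that
describes the relay input by one of `t` indices and transmits one of `t'` indices to the relay. -/
noncomputable def penalty (K : BlockKernels S U R X₁ X₂ Y₂ Y₃) (m t t' : ℝ) :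
    S × U × R × X₁ × X₂ × (Y₂ × Y₃) → ℝ :=
  fun (s, u, r, _, x₂, y) => mismatch ((K.pU s).1 u) ((K.q₃ y.2).1 u / m) +
    mismatch ((K.p₂ u s).1 x₂ / t) (K.qx.1 x₂) + mismatch ((K.pR u s).1 r) ((K.q₂ y.1).1 r / t')

/-- One-shot coding theorem: the source sends one of the messages in `M` to the destination and one
of the indices in `T'` to the relay, which knows an index in `T` of its own input. -/
theorem exists_block_code (K : BlockKernels S U R X₁ X₂ Y₂ Y₃) {M T T' : Type*} [Fintype M]
    [Fintype T] [Fintype T'] [Nonempty M] [Nonempty T] (ν : stdSimplex ℝ T') :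
    ∃ (idx : M → S → T) (rel : T → X₂) (src : M → T' → S → X₁) (d₂ : Y₂ → T') (d₃ : Y₃ → M),
      ∑ w, ∑ t', ∑ s, 1 / (Fintype.card M : ℝ) * ν.1 t' * K.Q.1 s *
        ∑ y, (K.W (src w t' s) (rel (idx w s)) s).1 y * ind (d₂ y.1 ≠ t' ∨ d₃ y.2 ≠ w) ≤
      ∑ z, K.law z * K.penalty (Fintype.card M) (Fintype.card T) (Fintype.card T') z := by
  classical
  have : Nonempty T' := nonempty_of_stdSimplex ν
  obtain ⟨s₀⟩ := nonempty_of_stdSimplex K.Q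
  obtain ⟨u₀⟩ := nonempty_of_stdSimplex (K.pU s₀)
  have : Nonempty U := ⟨u₀⟩
  obtain ⟨r₀⟩ := nonempty_of_stdSimplex (K.pR u₀ s₀)
  have : Nonempty R := ⟨r₀⟩
  have : Nonempty X₂ := nonempty_of_stdSimplex K.qx
  obtain ⟨k₁, π₁, f₁, g₁, hf₁, hg₁⟩ := exists_matching_message (M := M) K.pU K.q₃
  obtain ⟨k₂, π₂, f₂, g₂, hf₂, hg₂⟩ := exists_matching_index (T := T)
    (fun us : U × S => K.p₂ us.1 us.2) K.qx
  obtain ⟨k₃, π₃, f₃, g₃, hf₃, hg₃⟩ := exists_matching_message (M := T')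
    (fun us : U × S => K.pR us.1 us.2) K.q₂
  -- the error probability for a given input
  let V : Fin k₁ × Fin k₂ × Fin k₃ → M → T' → S → X₁ → ℝ := fun k w t' s x₁ =>
    ∑ y, (K.W x₁ (g₂ k.2.1 (f₂ k.2.1 (f₁ k.1 s w, s)).2) s).1 y *
      ind ((g₃ k.2.2 y.1).2 ≠ t' ∨ (g₁ k.1 y.2).2 ≠ w)
  -- With codebooks, message, index and states fixed, the error is averaged over the source input,
  -- so some deterministic input is at least as good as the random one.
  have hsrc : ∀ k w t' s, ∃ x₁, V k w t' s x₁ ≤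
      ∑ x, (K.p₁ (f₁ k.1 s w) (f₃ k.2.2 (f₁ k.1 s w, s) t') s).1 x * V k w t' s x := fun k w t' s =>
    exists_le_weighted_sum _ _
  choose src hsrc using hsrc
  -- the bound for each choice of the codebooks
  let D : Fin k₁ × Fin k₂ × Fin k₃ → M → T' → S → U × R × X₁ × (X₂ × T) × (Y₂ × Y₃) → ℝ :=
    fun k w t' s z => ind (f₁ k.1 s w = z.1) *
        ind (f₂ k.2.1 (z.1, s) = z.2.2.2.1 ∧ g₂ k.2.1 z.2.2.2.1.2 ≠ z.2.2.2.1.1) *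
        ind (f₃ k.2.2 (z.1, s) t' = z.2.1) +
      ind (f₁ k.1 s w = z.1 ∧ g₁ k.1 z.2.2.2.2.2 ≠ (z.1, w)) *
        ind (f₂ k.2.1 (z.1, s) = z.2.2.2.1) * ind (f₃ k.2.2 (z.1, s) t' = z.2.1) +
      ind (f₁ k.1 s w = z.1) * ind (f₂ k.2.1 (z.1, s) = z.2.2.2.1) *
        ind (f₃ k.2.2 (z.1, s) t' = z.2.1 ∧ g₃ k.2.2 z.2.2.2.2.1 ≠ (z.2.1, t'))
  have hD0 : ∀ k w t' s z, 0 ≤ D k w t' s z := fun k w t' s z =>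
    add_nonneg (add_nonneg (mul_nonneg (mul_nonneg (ind_nonneg _) (ind_nonneg _)) (ind_nonneg _))
      (mul_nonneg (mul_nonneg (ind_nonneg _) (ind_nonneg _)) (ind_nonneg _)))
      (mul_nonneg (mul_nonneg (ind_nonneg _) (ind_nonneg _)) (ind_nonneg _))
  -- The indicators in `D` leave only the selected `u`, `r` and `(x₂, t)`; the three terms of `D`
  -- charge a failed description, a failed destination and a failed relay.
  have hVD : ∀ k w t' s, V k w t' s (src k w t' s) ≤ ∑ u, ∑ r, ∑ xt : X₂ × T, ∑ x₁, ∑ y,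
      (K.p₁ u r s).1 x₁ * (K.W x₁ xt.1 s).1 y * D k w t' s (u, r, x₁, xt, y) := by
    intro k w t' s
    refine (hsrc k w t' s).trans ?_
    have h0 : ∀ u r (xt : X₂ × T) x₁ y,
        0 ≤ (K.p₁ u r s).1 x₁ * (K.W x₁ xt.1 s).1 y * D k w t' s (u, r, x₁, xt, y) :=
      fun u r xt x₁ y => mul_nonneg (mul_nonneg ((K.p₁ u r s).2.1 _) ((K.W x₁ xt.1 s).2.1 _))
        (hD0 ..)
    set u := f₁ k.1 s w with hu
    set r := f₃ k.2.2 (u, s) t' with hr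
    set xt := f₂ k.2.1 (u, s) with hxt
    refine le_trans ?_ (Finset.single_le_sum (fun u _ => Finset.sum_nonneg fun r _ =>
      Finset.sum_nonneg fun xt _ => Finset.sum_nonneg fun x₁ _ => Finset.sum_nonneg fun y _ =>
      h0 u r xt x₁ y) (mem_univ u))
    refine le_trans ?_ (Finset.single_le_sum (fun r _ =>
      Finset.sum_nonneg fun xt _ => Finset.sum_nonneg fun x₁ _ => Finset.sum_nonneg fun y _ =>
      h0 u r xt x₁ y) (mem_univ r))
    refine le_trans ?_ (Finset.single_le_sum (fun xt _ => Finset.sum_nonneg fun x₁ _ =>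
      Finset.sum_nonneg fun y _ => h0 u r xt x₁ y) (mem_univ xt))
    refine Finset.sum_le_sum fun x₁ _ => ?_
    simp only [mul_assoc, ← Finset.mul_sum]
    refine mul_le_mul_of_nonneg_left ?_ ((K.p₁ u r s).2.1 _)
    have hDv : ∀ y, D k w t' s (u, r, x₁, xt, y) = ind (g₂ k.2.1 xt.2 ≠ xt.1) +
        ind (g₁ k.1 y.2 ≠ (u, w)) + ind (g₃ k.2.2 y.1 ≠ (r, t')) := fun y => by
      simp only [D, ← hu, ← hr, ← hxt, true_and, ind_of, one_mul, mul_one]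
    simp only [hDv, V, ← hu, ← hxt]
    by_cases hx : g₂ k.2.1 xt.2 = xt.1
    · rw [hx]
      refine Finset.sum_le_sum fun y _ => mul_le_mul_of_nonneg_left ?_ ((K.W _ _ _).2.1 _)
      refine (ind_or_le _ _).trans ?_
      have h1 : ind ((g₃ k.2.2 y.1).2 ≠ t') ≤ ind (g₃ k.2.2 y.1 ≠ (r, t')) :=
        ind_mono fun h e => h (by rw [e])
      have h2 : ind ((g₁ k.1 y.2).2 ≠ w) ≤ ind (g₁ k.1 y.2 ≠ (u, w)) :=
        ind_mono fun h e => h (by rw [e])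
      have h3 := ind_nonneg (xt.1 ≠ xt.1)
      linarith
    -- If the relay does not recover the intended `x₂`, the actual channel law differs from the
    -- intended one. The error is then bounded by one, which the description term of `D` pays in
    -- full.
    · refine le_trans (b := 1) ?_ ?_
      · rw [← (K.W x₁ (g₂ k.2.1 xt.2) s).2.2]
        exact Finset.sum_le_sum fun y _ => mul_le_of_le_one_right ((K.W _ _ _).2.1 _) (ind_le_one _)
      · rw [← (K.W x₁ xt.1 s).2.2]
        refine Finset.sum_le_sum fun y _ => le_mul_of_one_le_right ((K.W _ _ _).2.1 _) ?_
        rw [ind_of hx]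
        linarith [ind_nonneg (g₁ k.1 y.2 ≠ (u, w)), ind_nonneg (g₃ k.2.2 y.1 ≠ (r, t'))]
  let π := prodSimplex π₁ (prodSimplex π₂ π₃)
  have hED : ∀ w t' s z, ∑ k, π.1 k * D k w t' s z ≤
      (K.pU s).1 z.1 * (K.pR z.1 s).1 z.2.1 * ((K.p₂ z.1 s).1 z.2.2.2.1.1 / Fintype.card T) *
        K.penalty (Fintype.card M) (Fintype.card T) (Fintype.card T')
          (s, z.1, z.2.1, z.2.2.1, z.2.2.2.1.1, z.2.2.2.2) := by
    rintro w t' s ⟨u, r, x₁, ⟨x₂, t⟩, y⟩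
    -- The three codebooks are independent, so expectations factor; in each term of `D` one factor
    -- is a mismatch probability and the other two are selection probabilities.
    have hfac : ∀ (a : Fin k₁ → ℝ) (b : Fin k₂ → ℝ) (c : Fin k₃ → ℝ),
        ∑ k, π.1 k * (a k.1 * b k.2.1 * c k.2.2) =
          (∑ x, π₁.1 x * a x) * (∑ x, π₂.1 x * b x) * ∑ x, π₃.1 x * c x := fun a b c => by
      rw [← sum_prod_three]
      refine Finset.sum_congr rfl fun k _ => ?_
      simp only [π, prodSimplex]
      ring
    simp only [D, mul_add, Finset.sum_add_distrib]
    rw [hfac (fun x => ind (f₁ x s w = u)) (fun x => ind (f₂ x (u, s) = (x₂, t) ∧ g₂ x t ≠ x₂))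
        (fun x => ind (f₃ x (u, s) t' = r)),
      hfac (fun x => ind (f₁ x s w = u ∧ g₁ x y.2 ≠ (u, w))) (fun x => ind (f₂ x (u, s) = (x₂, t)))
        (fun x => ind (f₃ x (u, s) t' = r)),
      hfac (fun x => ind (f₁ x s w = u)) (fun x => ind (f₂ x (u, s) = (x₂, t)))
        (fun x => ind (f₃ x (u, s) t' = r ∧ g₃ x y.1 ≠ (r, t')))]
    simp only [hf₁, hf₂, hf₃, penalty]
    have e1 := hg₁ s w y.2 u
    have e2 := hg₂ (u, s) x₂ t
    have e3 := hg₃ (u, s) t' y.1 r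
    have n1 := (K.pU s).2.1 u
    have n2 : 0 ≤ (K.p₂ u s).1 x₂ / (Fintype.card T : ℝ) :=
      div_nonneg ((K.p₂ u s).2.1 x₂) (Nat.cast_nonneg _)
    have n3 := (K.pR u s).2.1 r
    have b1 := mul_le_mul_of_nonneg_right (mul_le_mul_of_nonneg_left e2 n1) n3
    have b2 := mul_le_mul_of_nonneg_right (mul_le_mul_of_nonneg_right e1 n2) n3
    have b3 := mul_le_mul_of_nonneg_left e3 (mul_nonneg n1 n2)
    refine (add_le_add (add_le_add b1 b2) b3).trans (le_of_eq ?_)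
    ring
  obtain ⟨k, hk⟩ := exists_le_weighted_sum π fun k => ∑ w, ∑ t', ∑ s,
    1 / (Fintype.card M : ℝ) * ν.1 t' * K.Q.1 s * V k w t' s (src k w t' s)
  refine ⟨fun w s => (f₂ k.2.1 (f₁ k.1 s w, s)).2, g₂ k.2.1, src k, fun y => (g₃ k.2.2 y).2,
    fun y => (g₁ k.1 y).2, hk.trans ?_⟩
  have hV : ∀ w t' s, ∑ k, π.1 k * V k w t' s (src k w t' s) ≤ ∑ z : U × R × X₁ × X₂ × (Y₂ × Y₃),
      (K.pU s).1 z.1 * (K.pR z.1 s).1 z.2.1 * (K.p₁ z.1 z.2.1 s).1 z.2.2.1 *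
        (K.p₂ z.1 s).1 z.2.2.2.1 * (K.W z.2.2.1 z.2.2.2.1 s).1 z.2.2.2.2 *
        K.penalty (Fintype.card M) (Fintype.card T) (Fintype.card T') (s, z) := by
    intro w t' s
    have hT : (Fintype.card T : ℝ) ≠ 0 := Nat.cast_ne_zero.2 Fintype.card_ne_zero
    calc ∑ k, π.1 k * V k w t' s (src k w t' s)
        ≤ ∑ k, π.1 k * ∑ u, ∑ r, ∑ xt : X₂ × T, ∑ x₁, ∑ y,
          (K.p₁ u r s).1 x₁ * (K.W x₁ xt.1 s).1 y * D k w t' s (u, r, x₁, xt, y) :=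
          Finset.sum_le_sum fun k _ => mul_le_mul_of_nonneg_left (hVD k w t' s) (π.2.1 k)
      _ = ∑ u, ∑ r, ∑ xt : X₂ × T, ∑ x₁, ∑ y, (K.p₁ u r s).1 x₁ * (K.W x₁ xt.1 s).1 y *
          ∑ k, π.1 k * D k w t' s (u, r, x₁, xt, y) := by
          simp only [Finset.mul_sum]
          rw [Finset.sum_comm]
          refine Finset.sum_congr rfl fun u _ => ?_
          rw [Finset.sum_comm]
          refine Finset.sum_congr rfl fun r _ => ?_
          rw [Finset.sum_comm]
          refine Finset.sum_congr rfl fun xt _ => ?_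
          rw [Finset.sum_comm]
          refine Finset.sum_congr rfl fun x₁ _ => ?_
          rw [Finset.sum_comm]
          refine Finset.sum_congr rfl fun y _ => Finset.sum_congr rfl fun k _ => ?_
          ring
      _ ≤ ∑ u, ∑ r, ∑ xt : X₂ × T, ∑ x₁, ∑ y, (K.p₁ u r s).1 x₁ * (K.W x₁ xt.1 s).1 y *
          ((K.pU s).1 u * (K.pR u s).1 r * ((K.p₂ u s).1 xt.1 / Fintype.card T) *
          K.penalty (Fintype.card M) (Fintype.card T) (Fintype.card T')
            (s, u, r, x₁, xt.1, y)) := by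
          gcongr with u _ r _ xt _ x₁ _ y _
          · exact mul_nonneg ((K.p₁ u r s).2.1 _) ((K.W x₁ xt.1 s).2.1 _)
          · exact hED w t' s (u, r, x₁, xt, y)
      _ = _ := by
          simp only [Fintype.sum_prod_type, Finset.sum_const, card_univ, nsmul_eq_mul]
          refine Finset.sum_congr rfl fun u _ => Finset.sum_congr rfl fun r _ => ?_
          rw [Finset.sum_comm]
          simp only [Finset.mul_sum]
          refine Finset.sum_congr rfl fun x₂ _ => Finset.sum_congr rfl fun x₁ _ =>
            Finset.sum_congr rfl fun y₂ _ => Finset.sum_congr rfl fun y₃ _ => ?_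
          field_simp
  calc ∑ k, π.1 k * ∑ w, ∑ t', ∑ s,
        1 / (Fintype.card M : ℝ) * ν.1 t' * K.Q.1 s * V k w t' s (src k w t' s)
      = ∑ w : M, ∑ t', ∑ s, 1 / (Fintype.card M : ℝ) * ν.1 t' * K.Q.1 s *
          ∑ k, π.1 k * V k w t' s (src k w t' s) := by
        simp only [Finset.mul_sum]
        rw [Finset.sum_comm]
        refine Finset.sum_congr rfl fun w _ => ?_
        rw [Finset.sum_comm]
        refine Finset.sum_congr rfl fun t' _ => ?_
        rw [Finset.sum_comm]
        refine Finset.sum_congr rfl fun s _ => Finset.sum_congr rfl fun k _ => ?_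
        ring
    _ ≤ ∑ w : M, ∑ t', ∑ s, 1 / (Fintype.card M : ℝ) * ν.1 t' * K.Q.1 s *
          ∑ z : U × R × X₁ × X₂ × (Y₂ × Y₃),
            (K.pU s).1 z.1 * (K.pR z.1 s).1 z.2.1 * (K.p₁ z.1 z.2.1 s).1 z.2.2.1 *
            (K.p₂ z.1 s).1 z.2.2.2.1 * (K.W z.2.2.1 z.2.2.2.1 s).1 z.2.2.2.2 *
            K.penalty (Fintype.card M) (Fintype.card T) (Fintype.card T') (s, z) := by
        gcongr with w _ t' _ s _
        · exact mul_nonneg (mul_nonneg (by positivity) (ν.2.1 _)) (K.Q.2.1 _)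
        · exact hV w t' s
    _ = _ := by
        have hM : (Fintype.card M : ℝ) ≠ 0 := Nat.cast_ne_zero.2 Fintype.card_ne_zero
        simp only [mul_assoc, ← Finset.mul_sum, Finset.sum_const, card_univ, nsmul_eq_mul,
          ← Finset.sum_mul, ν.2.2, one_mul]
        rw [← mul_assoc, one_div_mul_cancel hM, one_mul, Fintype.sum_prod_type]
        refine Finset.sum_congr rfl fun s _ => ?_
        rw [Finset.mul_sum]
        refine Finset.sum_congr rfl fun z _ => ?_
        simp only [InputKernels.law]
        ring

end BlockKernels

/-! ### Product laws on sequences. -/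

section Power

variable {A B : Type*} [Fintype A] [Fintype B]

theorem sum_pi_prod {n : ℕ} (F : Fin n → A → ℝ) :
    ∑ a : Fin n → A, ∏ i, F i (a i) = ∏ i, ∑ a, F i a := by
  classical
  rw [Finset.prod_univ_sum, Fintype.piFinset_univ]

/-- The law of `n` independent random variables. -/
def piSimplex {n : ℕ} (p : Fin n → stdSimplex ℝ A) : stdSimplex ℝ (Fin n → A) :=
  ⟨fun a => ∏ i, (p i).1 (a i), fun a => Finset.prod_nonneg fun i _ => (p i).2.1 _, by
    rw [sum_pi_prod fun i a => (p i).1 a, Finset.prod_eq_one fun i _ => (p i).2.2]⟩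

/-- The law of `n` independent pairs, as the law of a pair of sequences. -/
def piPairSimplex {n : ℕ} (p : Fin n → stdSimplex ℝ (A × B)) :
    stdSimplex ℝ ((Fin n → A) × (Fin n → B)) :=
  ⟨fun y => ∏ i, (p i).1 (y.1 i, y.2 i), fun y => Finset.prod_nonneg fun i _ => (p i).2.1 _, by
    rw [← (piSimplex p).2.2]
    exact ((Equiv.arrowProdEquivProdArrow (Fin n) (fun _ => A) fun _ => B).sum_comp
      fun y : (Fin n → A) × (Fin n → B) => ∏ i, (p i).1 (y.1 i, y.2 i)).symm⟩

theorem sum_append {m n : ℕ} (F : (Fin (m + n) → A) → ℝ) :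
    ∑ a, F a = ∑ a, ∑ b, F (Fin.append a b) := by
  rw [← (Fin.appendEquiv m n).sum_comp, Fintype.sum_prod_type]
  rfl

end Power

/-! ### Codes for a relay with an index, and their concatenation. -/

/-- A code of length `n` for a relay that knows in advance an index in `T`, which depends on the
message and the states. -/
structure IndexedCode (S X₁ X₂ Y₂ Y₃ T M : Type*) (n : ℕ) where
  /-- index known to the relay -/
  index : M → (Fin n → S) → T
  /-- encoding function of the source -/
  source : M → (Fin n → S) → (Fin n → X₁)
  /-- encoding functions of the relay -/
  relay : T → Fin n → (Fin n → Y₂) → X₂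
  /-- decoding function of the destination -/
  decode : (Fin n → Y₃) → M
  /-- the relay input depends only on earlier relay outputs -/
  causal : ∀ t i y y', (∀ j, j < i → y j = y' j) → relay t i y = relay t i y'

namespace IndexedCode

variable {S X₁ X₂ Y₂ Y₃ T M : Type*} [Fintype S] [Fintype Y₂] [Fintype Y₃]

/-- The law of the outputs when the relay uses the index `t`. -/
def kernel (W : X₁ → X₂ → S → stdSimplex ℝ (Y₂ × Y₃)) {n : ℕ}
    (c : IndexedCode S X₁ X₂ Y₂ Y₃ T M n) (w : M) (s : Fin n → S) (t : T)
    (y : (Fin n → Y₂) × (Fin n → Y₃)) : ℝ :=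
  ∏ i, (W (c.source w s i) (c.relay t i y.1) (s i)).1 (y.1 i, y.2 i)

theorem kernel_nonneg {S X₁ X₂ Y₂ Y₃ T M : Type*} [Fintype Y₂] [Fintype Y₃]
    (W : X₁ → X₂ → S → stdSimplex ℝ (Y₂ × Y₃)) {n : ℕ}
    (c : IndexedCode S X₁ X₂ Y₂ Y₃ T M n) (w : M) (s : Fin n → S) (t : T)
    (y : (Fin n → Y₂) × (Fin n → Y₃)) : 0 ≤ c.kernel W w s t y :=
  Finset.prod_nonneg fun _ _ => (W _ _ _).2.1 _

/-- The law of message and states. -/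
noncomputable def inputLaw [Fintype M] [Nonempty M] (Q : stdSimplex ℝ S) (n : ℕ) :
    stdSimplex ℝ (M × (Fin n → S)) :=
  prodSimplex (uniformSimplex M) (piSimplex fun _ => Q)

/-- The probability of a decoding error given message and states. -/
noncomputable def condError (W : X₁ → X₂ → S → stdSimplex ℝ (Y₂ × Y₃)) {n : ℕ}
    (c : IndexedCode S X₁ X₂ Y₂ Y₃ T M n) (w : M) (s : Fin n → S) : ℝ :=
  ∑ y, c.kernel W w s (c.index w s) y * ind (c.decode y.2 ≠ w)

end IndexedCode

section Codes

variable {S X₁ X₂ Y₂ Y₃ : Type*} [Fintype S] [Fintype Y₂] [Fintype Y₃]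

/-- There is a code of length `n` with messages in `M` for a relay that knows an index in `T`, with
average probability of error at most `ε`. -/
def HasIndexedCode (Q : stdSimplex ℝ S) (W : X₁ → X₂ → S → stdSimplex ℝ (Y₂ × Y₃))
    (T M : Type*) [Fintype M] [Nonempty M] (n : ℕ) (ε : ℝ) : Prop :=
  ∃ c : IndexedCode S X₁ X₂ Y₂ Y₃ T M n, (∀ w s t, ∑ y, c.kernel W w s t y = 1) ∧
    ∑ x, (IndexedCode.inputLaw Q n).1 x * c.condError W x.1 x.2 ≤ ε

/-- There is a block code of length `n` that sends a message in `M` to the destination and, to the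
relay, an index in `T'` of law `ν`, when the relay knows an index in `T`, with probability at most
`ε` that one of the two is decoded incorrectly. -/
def HasBlockCode (Q : stdSimplex ℝ S) (W : X₁ → X₂ → S → stdSimplex ℝ (Y₂ × Y₃))
    (T M : Type*) {T' : Type*} [Fintype M] [Fintype T'] (ν : stdSimplex ℝ T')
    (n : ℕ) (ε : ℝ) : Prop :=
  ∃ (idx : M → (Fin n → S) → T) (rel : T → (Fin n → X₂)) (src : M → T' → (Fin n → S) → (Fin n → X₁))
    (d₂ : (Fin n → Y₂) → T') (d₃ : (Fin n → Y₃) → M),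
    ∑ w, ∑ t', ∑ s, 1 / (Fintype.card M : ℝ) * ν.1 t' * (piSimplex fun _ => Q).1 s *
      ∑ y, (piPairSimplex fun i => W (src w t' s i) (rel (idx w s) i) (s i)).1 y *
        ind (d₂ y.1 ≠ t' ∨ d₃ y.2 ≠ w) ≤ ε

/-- The trivial code. -/
theorem hasIndexedCode_unit (Q : stdSimplex ℝ S) (W : X₁ → X₂ → S → stdSimplex ℝ (Y₂ × Y₃))
    (T : Type*) [Nonempty T] [Nonempty X₁] [Nonempty X₂] (n : ℕ) :
    HasIndexedCode Q W T Unit n 0 := by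
  obtain ⟨t₀⟩ := ‹Nonempty T›
  obtain ⟨x₁⟩ := ‹Nonempty X₁›
  obtain ⟨x₂⟩ := ‹Nonempty X₂›
  refine ⟨⟨fun _ _ => t₀, fun _ _ _ => x₁, fun _ _ _ => x₂, fun _ => (), fun _ _ _ _ _ => rfl⟩,
    fun w s t => (piPairSimplex fun i => W x₁ x₂ (s i)).2.2, ?_⟩
  simp [IndexedCode.condError, ind]

/-- The law of the index of a code. -/
noncomputable def indexLaw (Q : stdSimplex ℝ S) {T M : Type*} [Fintype T] [Fintype M] [Nonempty M]
    {n : ℕ} (f : M → (Fin n → S) → T) : stdSimplex ℝ T :=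
  ⟨fun t => ∑ x, (IndexedCode.inputLaw Q n).1 x * ind (f x.1 x.2 = t),
    fun t => Finset.sum_nonneg fun x _ => mul_nonneg ((IndexedCode.inputLaw Q n).2.1 x)
      (ind_nonneg _), by
    rw [Finset.sum_comm]
    simp only [← Finset.mul_sum, sum_ind_eq, mul_one]
    exact (IndexedCode.inputLaw Q n).2.2⟩

/-- A block code that transmits the index of an indexed code can be put in front of it. -/
theorem HasIndexedCode.cons {Q : stdSimplex ℝ S} {W : X₁ → X₂ → S → stdSimplex ℝ (Y₂ × Y₃)}
    {T T' M M' : Type*} [Fintype T'] [Fintype M] [Nonempty M] [Fintype M'] [Nonempty M'] {m n : ℕ}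
    {ε ε' : ℝ} (hb : ∀ ν : stdSimplex ℝ T', HasBlockCode Q W T M ν m ε)
    (hc : HasIndexedCode Q W T' M' n ε') :
    HasIndexedCode Q W T (M × M') (m + n) (ε + ε') := by
  obtain ⟨c, hc1, hce⟩ := hc
  -- The index to be sent is distributed as the code that follows dictates, which is why block codes
  -- are required for every law `ν`.
  obtain ⟨idx, rel, src, d₂, d₃, hbe⟩ := hb (indexLaw Q c.index)
  let C : IndexedCode S X₁ X₂ Y₂ Y₃ T (M × M') (m + n) :=
    { index := fun w s => idx w.1 fun i => s (Fin.castAdd n i)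
      -- Noncausal knowledge enters here: during the first `m` uses the source needs the index
      -- determined by the states of the last `n`.
      source := fun w s => Fin.append
        (src w.1 (c.index w.2 fun j => s (Fin.natAdd m j)) fun i => s (Fin.castAdd n i))
        (c.source w.2 fun j => s (Fin.natAdd m j))
      relay := fun t i y => Fin.append (rel t)
        (fun j => c.relay (d₂ fun k => y (Fin.castAdd n k)) j fun k => y (Fin.natAdd m k)) i
      decode := fun y => (d₃ fun k => y (Fin.castAdd n k), c.decode fun k => y (Fin.natAdd m k))
      causal := by
        intro t i y y' h
        refine Fin.addCases (fun i h => ?_) (fun i h => ?_) i h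
        · simp only [Fin.append_left]
        · simp only [Fin.append_right]
          have h1 : (fun k => y (Fin.castAdd n k)) = fun k => y' (Fin.castAdd n k) := by
            funext k
            exact h _ (by simp only [Fin.lt_def, Fin.val_castAdd, Fin.val_natAdd]; omega)
          rw [h1]
          refine c.causal _ _ _ _ fun j hj => h _ ?_
          simp only [Fin.lt_def, Fin.val_natAdd] at hj ⊢
          omega }
  have hsum : ∀ F : ((Fin (m + n) → Y₂) × (Fin (m + n) → Y₃)) → ℝ, ∑ y, F y =
      ∑ y : (Fin m → Y₂) × (Fin m → Y₃), ∑ y' : (Fin n → Y₂) × (Fin n → Y₃),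
        F (Fin.append y.1 y'.1, Fin.append y.2 y'.2) := by
    intro F
    simp only [Fintype.sum_prod_type, sum_append]
    refine Finset.sum_congr rfl fun a _ => ?_
    rw [Finset.sum_comm]
  have hker : ∀ w s s' t y y', C.kernel W w (Fin.append s s') t
      (Fin.append y.1 y'.1, Fin.append y.2 y'.2) =
      (piPairSimplex fun i => W (src w.1 (c.index w.2 s') s i) (rel t i) (s i)).1 y *
        c.kernel W w.2 s' (d₂ y.1) y' := by
    intro w s s' t y y'
    simp [C, IndexedCode.kernel, piPairSimplex, Fin.prod_univ_add]
  have htot : ∀ (w : M × M') (s : Fin m → S) (s' : Fin n → S) (t : T),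
      ∑ y, C.kernel W w (Fin.append s s') t y = 1 := by
    intro w s s' t
    rw [hsum]
    simp only [hker, ← Finset.mul_sum, hc1, mul_one]
    exact (piPairSimplex _).2.2
  refine ⟨C, fun w s t => ?_, ?_⟩
  · obtain ⟨⟨s, s'⟩, rfl⟩ := (Fin.appendEquiv m n).surjective s
    exact htot w s s' t
  -- the conditional error probability
  let G : M → T' → (Fin m → S) → ℝ := fun w t' s =>
    ∑ y, (piPairSimplex fun i => W (src w t' s i) (rel (idx w s) i) (s i)).1 y *
        ind (d₂ y.1 ≠ t' ∨ d₃ y.2 ≠ w)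
  have hcond : ∀ w s s', C.condError W w (Fin.append s s') ≤
      G w.1 (c.index w.2 s') s + c.condError W w.2 s' := by
    intro w s s'
    have hidx : C.index w (Fin.append s s') = idx w.1 s := by simp [C]
    set p := piPairSimplex fun i => W (src w.1 (c.index w.2 s') s i) (rel (idx w.1 s) i) (s i)
      with hp
    have : G w.1 (c.index w.2 s') s + c.condError W w.2 s' =
        ∑ y, p.1 y * (ind (d₂ y.1 ≠ c.index w.2 s' ∨ d₃ y.2 ≠ w.1) + c.condError W w.2 s') := by
      simp only [mul_add, Finset.sum_add_distrib, ← Finset.sum_mul, p.2.2, one_mul]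
      rfl
    rw [this, IndexedCode.condError, hsum]
    simp only [hidx, hker, mul_assoc, ← Finset.mul_sum]
    refine Finset.sum_le_sum fun y _ => mul_le_mul_of_nonneg_left ?_ (p.2.1 y)
    have hdec : ∀ y', C.decode (Fin.append y.2 y') = (d₃ y.2, c.decode y') := fun y' => by
      simp [C]
    simp only [hdec]
    by_cases hbad : d₂ y.1 ≠ c.index w.2 s' ∨ d₃ y.2 ≠ w.1
    · rw [ind_of hbad]
      have h1 : 0 ≤ c.condError W w.2 s' := Finset.sum_nonneg fun y _ =>
        mul_nonneg (c.kernel_nonneg W _ _ _ _) (ind_nonneg _)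
      refine le_trans (b := 1) ?_ (by linarith)
      -- The relay may continue with a wrong index, so the kernel must have total mass one at every
      -- index.
      rw [← hc1 w.2 s' (d₂ y.1)]
      exact Finset.sum_le_sum fun y' _ => mul_le_of_le_one_right (c.kernel_nonneg W _ _ _ _)
        (ind_le_one _)
    · rw [ind_of_not hbad, zero_add]
      push Not at hbad
      rw [hbad.1, hbad.2, IndexedCode.condError]
      refine Finset.sum_le_sum fun y' _ => mul_le_mul_of_nonneg_left (ind_mono ?_)
        (c.kernel_nonneg W _ _ _ _)
      intro h e
      exact h (by rw [e])
  -- Message and states of the remaining code are independent of those of the front block; averaging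
  -- over them gives the index its law `indexLaw`.
  have hfirst : ∑ w, ∑ s, ∑ x', (1 / (Fintype.card M : ℝ)) * (piSimplex fun _ => Q).1 s *
      (IndexedCode.inputLaw (M := M') Q n).1 x' * G w (c.index x'.1 x'.2) s ≤ ε := by
    change ∑ w, ∑ t', ∑ s, 1 / (Fintype.card M : ℝ) * (indexLaw Q c.index).1 t' *
      (piSimplex fun _ => Q).1 s * G w t' s ≤ ε at hbe
    refine le_trans (le_of_eq ?_) hbe
    refine Finset.sum_congr rfl fun w _ => ?_
    rw [Finset.sum_comm (γ := T')]
    refine Finset.sum_congr rfl fun s _ => ?_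
    have : ∀ x' : M' × (Fin n → S), G w (c.index x'.1 x'.2) s =
        ∑ t', ind (c.index x'.1 x'.2 = t') * G w t' s := fun x' => by
      classical
      simp [ind]
    simp only [this, Finset.mul_sum]
    rw [Finset.sum_comm]
    refine Finset.sum_congr rfl fun t' _ => ?_
    change _ = 1 / (Fintype.card M : ℝ) *
      (∑ x, (IndexedCode.inputLaw Q n).1 x * ind (c.index x.1 x.2 = t')) *
      (piSimplex fun _ => Q).1 s * G w t' s
    simp only [Finset.sum_mul, Finset.mul_sum]
    exact Finset.sum_congr rfl fun x _ => by ring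
  have hQ : ∀ s s', (piSimplex fun _ : Fin (m + n) => Q).1 (Fin.append s s') =
      (piSimplex fun _ => Q).1 s * (piSimplex fun _ => Q).1 s' := fun s s' => by
    simp [piSimplex, Fin.prod_univ_add]
  have hlaw : ∀ w s s', (IndexedCode.inputLaw (M := M × M') Q (m + n)).1 (w, Fin.append s s') =
      1 / (Fintype.card M : ℝ) * (piSimplex fun _ => Q).1 s *
        (IndexedCode.inputLaw (M := M') Q n).1 (w.2, s') := by
    intro w s s'
    simp only [IndexedCode.inputLaw, prodSimplex, uniformSimplex, hQ, Fintype.card_prod,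
      Nat.cast_mul]
    field_simp
  have hM : (Fintype.card M : ℝ) ≠ 0 := Nat.cast_ne_zero.2 Fintype.card_ne_zero
  calc ∑ x, (IndexedCode.inputLaw Q (m + n)).1 x * C.condError W x.1 x.2
      = ∑ w, ∑ s, ∑ x' : M' × (Fin n → S), (1 / (Fintype.card M : ℝ)) * (piSimplex fun _ => Q).1 s *
          (IndexedCode.inputLaw (M := M') Q n).1 x' *
            C.condError W (w, x'.1) (Fin.append s x'.2) := by
        simp only [Fintype.sum_prod_type, sum_append, hlaw]
        exact Finset.sum_congr rfl fun w _ => Finset.sum_comm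
    _ ≤ ∑ w, ∑ s, ∑ x' : M' × (Fin n → S), (1 / (Fintype.card M : ℝ)) * (piSimplex fun _ => Q).1 s *
          (IndexedCode.inputLaw (M := M') Q n).1 x' *
            (G w (c.index x'.1 x'.2) s + c.condError W x'.1 x'.2) := by
        gcongr with w _ s _ x' _
        · exact mul_nonneg (mul_nonneg (by positivity) ((piSimplex _).2.1 _))
            ((IndexedCode.inputLaw Q n).2.1 _)
        · exact hcond (w, x'.1) s x'.2
    _ ≤ ε + ε' := by
        simp only [mul_add, Finset.sum_add_distrib]
        refine add_le_add hfirst (le_trans (le_of_eq ?_) hce)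
        simp only [mul_assoc, ← Finset.mul_sum, ← Finset.sum_mul, (piSimplex fun _ => Q).2.2,
          Finset.sum_const, card_univ, nsmul_eq_mul, one_mul]
        rw [← mul_assoc, one_div_mul_cancel hM, one_mul]

/-- Codes for a relay that knows nothing in advance are relay codes. -/
theorem HasIndexedCode.exists_relayCode {Q : stdSimplex ℝ S}
    {W : X₁ → X₂ → S → stdSimplex ℝ (Y₂ × Y₃)} {M : Type*} [Fintype M] [Nonempty M] {n N : ℕ}
    [Nonempty Y₂] {ε : ℝ} (hc : HasIndexedCode Q W Unit M n ε) (hN : 0 < N)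
    (hNM : N ≤ Fintype.card M) :
    ∃ c : RelayCode S X₁ X₂ Y₂ Y₃ N n, c.errorProb Q W ≤ ε := by
  classical
  obtain ⟨c, -, hce⟩ := hc
  obtain ⟨y₀⟩ := ‹Nonempty Y₂›
  set K := Fintype.card M with hK
  have : NeZero K := ⟨Fintype.card_ne_zero⟩
  have : NeZero N := ⟨hN.ne'⟩
  let e : M ≃ Fin K := Fintype.equivFin M
  -- messages shifted cyclically by `k`
  let φ : Fin K → Fin N → M := fun k j => e.symm (k + Fin.castLE hNM j)
  have hφ : ∀ k, Function.Injective (φ k) := fun k i j h => by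
    have := add_left_cancel (e.symm.injective h)
    exact Fin.castLE_injective hNM this
  let c' : Fin K → RelayCode S X₁ X₂ Y₂ Y₃ N n := fun k =>
    { source := fun w s => c.source (φ k w) s
      -- The outputs from time `i` on are filled with `y₀`; by `causal` this does not affect the
      -- relay input.
      relay := fun i z => c.relay () i fun j => if h : j < i then z ⟨j, h⟩ else y₀
      decode := fun y => Function.invFun (φ k) (c.decode y) }
  let F : M → ℝ := fun w => ∑ s, (piSimplex fun _ => Q).1 s * c.condError W w s
  have hF : (1 / (K : ℝ)) * ∑ w, F w ≤ ε := by
    refine le_trans (le_of_eq ?_) hce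
    simp only [F, Fintype.sum_prod_type, IndexedCode.inputLaw, prodSimplex, uniformSimplex,
      Finset.mul_sum, mul_assoc, hK]
  have herr : ∀ k, (c' k).errorProb Q W ≤ (1 / (N : ℝ)) * ∑ j, F (φ k j) := by
    intro k
    simp only [RelayCode.errorProb, F, Finset.mul_sum, IndexedCode.condError, Fintype.sum_prod_type]
    gcongr with j _ s _ y₂ _ y₃ _
    have hrel : ∀ i, (c' k).relay i (fun j => y₂ (Fin.castLE i.isLt.le j)) = c.relay () i y₂ := by
      intro i
      refine c.causal _ _ _ _ fun j hj => ?_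
      simp [hj]
    have hprob : (c' k).prob Q W j s y₂ y₃ = 1 / (N : ℝ) * ((piSimplex fun _ => Q).1 s *
        c.kernel W (φ k j) s () (y₂, y₃)) := by
      simp only [RelayCode.prob, hrel, Finset.prod_mul_distrib]
      rfl
    have : c.index (φ k j) s = () := rfl
    rw [this, hprob]
    split_ifs with h
    · have : c.decode y₃ ≠ φ k j := fun e => h (by
        change Function.invFun (φ k) (c.decode y₃) = j
        rw [e]
        exact Function.leftInverse_invFun (hφ k) j)
      rw [ind_of this, mul_one]
    · exact mul_nonneg (by positivity) (mul_nonneg ((piSimplex _).2.1 _)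
        (mul_nonneg (c.kernel_nonneg W _ _ _ _) (ind_nonneg _)))
  obtain ⟨k, hk⟩ := exists_le_weighted_sum (uniformSimplex (Fin K)) fun k =>
    (1 / (N : ℝ)) * ∑ j, F (φ k j)
  refine ⟨c' k, (herr k).trans (hk.trans (le_trans (le_of_eq ?_) hF))⟩
  have hN' : (N : ℝ) ≠ 0 := Nat.cast_ne_zero.2 hN.ne'
  -- For fixed `j`, the shifts run through every message exactly once, so the mean over shifts of
  -- the error on `N` messages is the error on all of `M`.
  have hs : ∀ j, ∑ k, F (φ k j) = ∑ w, F w := fun j => by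
    rw [← e.symm.sum_comp F]
    exact Equiv.sum_comp (Equiv.addRight (Fin.castLE hNM j)) fun k => F (e.symm k)
  simp only [uniformSimplex, Fintype.card_fin, ← Finset.mul_sum]
  rw [Finset.sum_comm]
  simp only [hs, Finset.sum_const, card_univ, Fintype.card_fin, nsmul_eq_mul]
  field_simp

end Codes

/-! ### Exponential decay of the mismatch on sequences. -/

section Chernoff

variable {Ω : Type*} [Fintype Ω]

/-- As a function of `c` the sum equals `1` at `0`, and its derivative there is `log 2` times the
negative quantity in `h`. -/
theorem exists_sum_rpow_lt_one {p r : Ω → ℝ} (hp1 : ∑ ω, p ω = 1)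
    (hr : ∀ ω, p ω ≠ 0 → 0 < r ω) {R : ℝ} (h : ∑ ω, p ω * Real.logb 2 (r ω) + R < 0) :
    ∃ c : ℝ, 0 < c ∧ c ≤ 1 ∧ ∑ ω, p ω * (2 ^ R * r ω) ^ c < 1 := by
  have hl : 0 < Real.log 2 := Real.log_pos one_lt_two
  let d : Ω → ℝ := fun ω => (R + Real.logb 2 (r ω)) * Real.log 2
  let f : ℝ → ℝ := fun c => ∑ ω, p ω * Real.exp (c * d ω)
  have hf : HasDerivAt f (∑ ω, p ω * d ω) 0 := by
    refine HasDerivAt.fun_sum fun ω _ => HasDerivAt.const_mul _ ?_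
    have := ((hasDerivAt_id (0 : ℝ)).mul_const (d ω)).exp
    simpa using this
  have hd : ∑ ω, p ω * d ω < 0 := by
    have : ∑ ω, p ω * d ω = (∑ ω, p ω * Real.logb 2 (r ω) + R) * Real.log 2 := by
      rw [← mul_one R, ← hp1, Finset.mul_sum, ← Finset.sum_add_distrib, Finset.sum_mul]
      refine Finset.sum_congr rfl fun ω _ => ?_
      simp only [d]
      ring
    rw [this]
    exact mul_neg_of_neg_of_pos h hl
  have hf0 : f 0 = 1 := by simp [f, hp1]
  have hslope := hf.tendsto_slope_zero_right
  have hev := (hslope.eventually_lt_const hd).and (Ioo_mem_nhdsGT (zero_lt_one' ℝ))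
  obtain ⟨c, hc, hc0, hc1⟩ := hev.exists
  refine ⟨c, hc0, hc1.le, ?_⟩
  have hfc : f c < 1 := by
    rw [zero_add, hf0, smul_eq_mul] at hc
    by_contra! h1
    exact absurd hc (not_lt.2 (mul_nonneg (inv_nonneg.2 hc0.le) (by linarith)))
  refine lt_of_eq_of_lt (Finset.sum_congr rfl fun ω _ => ?_) hfc
  by_cases hω : p ω = 0
  · simp [hω]
  · have h2 := Real.rpow_pos_of_pos two_pos R
    rw [Real.rpow_def_of_pos (mul_pos h2 (hr ω hω)), Real.log_mul h2.ne' (hr ω hω).ne',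
      Real.log_rpow two_pos]
    congr 2
    simp only [d, Real.logb]
    field_simp

theorem mismatch_nonneg {p q : ℝ} (hp : 0 ≤ p) (hq : 0 ≤ q) (hq1 : q ≤ 1) : 0 ≤ mismatch p q := by
  have := mul_nonneg hp (sub_nonneg.2 hq1)
  exact div_nonneg this (by linarith)

/-- The mismatch is at most `min 1 (p / q)`, and this lies below every power with exponent in `(0,
1]`. -/
theorem mismatch_le_rpow {p q c : ℝ} (hp : 0 ≤ p) (hq : 0 < q) (hq1 : q ≤ 1) (hc : 0 < c)
    (hc1 : c ≤ 1) : mismatch p q ≤ (p / q) ^ c := by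
  have h0 := mul_nonneg hp (sub_nonneg.2 hq1)
  have h1 : mismatch p q ≤ 1 := div_le_one_of_le₀ (by linarith) (by linarith)
  have h2 : mismatch p q ≤ p / q := by
    refine div_le_div₀ hp ?_ hq (by linarith)
    nlinarith
  have h3 : 0 ≤ p / q := div_nonneg hp hq.le
  rcases le_total (p / q) 1 with h | h
  · refine h2.trans ?_
    conv_lhs => rw [← Real.rpow_one (p / q)]
    rcases h3.eq_or_lt with h4 | h4
    · rw [← h4, Real.zero_rpow one_ne_zero, Real.zero_rpow hc.ne']
    · exact Real.rpow_le_rpow_of_exponent_ge h4 h hc1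
  · exact h1.trans (Real.one_le_rpow h hc.le)

theorem mismatch_one_right (p : ℝ) : mismatch p 1 = 0 := by simp [mismatch]

/-- After the bound by a `c`-th power the sum over sequences factors into `2 ^ c * ρ ^ n` with `ρ <
1`. The factor `2` in `hab` leaves room for rounding the number of messages up to an integer. -/
theorem tendsto_sum_mismatch {p P Q : Ω → ℝ} (hp : ∀ ω, 0 ≤ p ω) (hp1 : ∑ ω, p ω = 1)
    (hP : ∀ ω, p ω ≠ 0 → 0 < P ω) (hQ : ∀ ω, p ω ≠ 0 → 0 < Q ω) (hQ1 : ∀ ω, Q ω ≤ 1) {R : ℝ}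
    (h : ∑ ω, p ω * Real.logb 2 (P ω / Q ω) + R < 0) {a b : ℕ → ℝ} (ha : ∀ n, 0 ≤ a n)
    (hb : ∀ n, 0 < b n) (hb1 : ∀ n, b n ≤ 1)
    (hab : ∀ n, a n ≤ 2 * 2 ^ ((n : ℝ) * R) * b n) :
    Tendsto (fun n : ℕ => ∑ z : Fin n → Ω, (∏ i, p (z i)) *
      mismatch (a n * ∏ i, P (z i)) (b n * ∏ i, Q (z i))) atTop (𝓝 0) := by
  obtain ⟨c, hc, hc1, hlt⟩ := exists_sum_rpow_lt_one hp1
    (fun ω hω => div_pos (hP ω hω) (hQ ω hω)) h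
  set ρ := ∑ ω, p ω * (2 ^ R * (P ω / Q ω)) ^ c with hρ
  have hρ0 : 0 ≤ ρ := Finset.sum_nonneg fun ω _ => by
    by_cases hω : p ω = 0
    · simp [hω]
    · exact mul_nonneg (hp ω) (Real.rpow_nonneg (mul_nonneg (Real.rpow_nonneg two_pos.le _)
        (div_pos (hP ω hω) (hQ ω hω)).le) _)
  have hz : ∀ (n : ℕ) (z : Fin n → Ω), ∏ i, p (z i) ≠ 0 →
      (0 ≤ a n * ∏ i, P (z i)) ∧ 0 < b n * ∏ i, Q (z i) ∧ b n * ∏ i, Q (z i) ≤ 1 := by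
    intro n z hz
    have hz' : ∀ i, p (z i) ≠ 0 := fun i => Finset.prod_ne_zero_iff.1 hz i (mem_univ i)
    have hQ0 : 0 < ∏ i, Q (z i) := Finset.prod_pos fun i _ => hQ _ (hz' i)
    refine ⟨mul_nonneg (ha n) (Finset.prod_nonneg fun i _ => (hP _ (hz' i)).le),
      mul_pos (hb n) hQ0, mul_le_one₀ (hb1 n) hQ0.le ?_⟩
    exact Finset.prod_le_one (fun i _ => (hQ _ (hz' i)).le) fun i _ => hQ1 _
  have hlim : Tendsto (fun n : ℕ => (2 : ℝ) ^ c * ρ ^ n) atTop (𝓝 0) := by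
    simpa using (tendsto_pow_atTop_nhds_zero_of_lt_one hρ0 hlt).const_mul ((2 : ℝ) ^ c)
  refine squeeze_zero (fun n => Finset.sum_nonneg fun z _ => ?_) (fun n => ?_) hlim
  · by_cases h0 : ∏ i, p (z i) = 0
    · simp [h0]
    · obtain ⟨h1, h2, h3⟩ := hz n z h0
      exact mul_nonneg (Finset.prod_nonneg fun i _ => hp _) (mismatch_nonneg h1 h2.le h3)
  · rw [hρ, Fintype.sum_pow, Finset.mul_sum]
    refine Finset.sum_le_sum fun z _ => ?_
    by_cases h0 : ∏ i, p (z i) = 0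
    · rw [h0, zero_mul, Finset.prod_mul_distrib, h0, zero_mul, mul_zero]
    · obtain ⟨h1, h2, h3⟩ := hz n z h0
      have hz' : ∀ i, p (z i) ≠ 0 := fun i => Finset.prod_ne_zero_iff.1 h0 i (mem_univ i)
      rw [Finset.prod_mul_distrib, mul_left_comm]
      refine mul_le_mul_of_nonneg_left ?_ (Finset.prod_nonneg fun i _ => hp _)
      refine (mismatch_le_rpow h1 h2 h3 hc hc1).trans ?_
      have hpos : ∀ i, 0 ≤ P (z i) / Q (z i) := fun i => (div_pos (hP _ (hz' i)) (hQ _ (hz' i))).le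
      have h2R := Real.rpow_nonneg two_pos.le R
      rw [Real.finsetProd_rpow _ _ fun i _ => mul_nonneg h2R (hpos i),
        ← Real.mul_rpow two_pos.le (Finset.prod_nonneg fun i _ => mul_nonneg h2R (hpos i))]
      refine Real.rpow_le_rpow (div_nonneg h1 h2.le) ?_ hc.le
      rw [mul_div_mul_comm, ← Finset.prod_div_distrib, Finset.prod_mul_distrib, Finset.prod_const,
        card_univ, Fintype.card_fin, ← Real.rpow_natCast, ← Real.rpow_mul two_pos.le, mul_comm R,
        ← mul_assoc]
      refine mul_le_mul_of_nonneg_right ?_ (Finset.prod_nonneg fun i _ => hpos i)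
      rw [div_le_iff₀ (hb n)]
      exact hab n

end Chernoff

/-! ### Error terms of blocks of growing length. -/

namespace InputKernels

variable {S U R X₁ X₂ Y₂ Y₃ : Type*} [Fintype S] [Fintype U] [Fintype R]
    [Fintype X₁] [Fintype X₂] [Fintype Y₂] [Fintype Y₃]

theorem law_nonneg (K : InputKernels S U R X₁ X₂ Y₂ Y₃) (z) : 0 ≤ K.law z :=
  mul_nonneg (mul_nonneg (mul_nonneg (mul_nonneg (mul_nonneg (K.Q.2.1 _) ((K.pU _).2.1 _))
    ((K.pR _ _).2.1 _)) ((K.p₁ _ _ _).2.1 _)) ((K.p₂ _ _).2.1 _)) ((K.W _ _ _).2.1 _)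

theorem sum_law (K : InputKernels S U R X₁ X₂ Y₂ Y₃) : ∑ z, K.law z = 1 := by
  have h : ∀ (p : stdSimplex ℝ (Y₂ × Y₃)), ∑ a, ∑ b, p.1 (a, b) = 1 := fun p => by
    rw [← Fintype.sum_prod_type]; exact p.2.2
  simp only [Fintype.sum_prod_type, law, ← Finset.mul_sum, h, mul_one, (K.p₂ _ _).2.2,
    (K.p₁ _ _ _).2.2, (K.pR _ _).2.2, (K.pU _).2.2, K.Q.2.2]

end InputKernels

namespace BlockKernels

variable {S U R X₁ X₂ Y₂ Y₃ : Type*} [Fintype S] [Fintype U] [Fintype R]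
    [Fintype X₁] [Fintype X₂] [Fintype Y₂] [Fintype Y₃]

/-- The kernels for blocks of length `n`. -/
def power (K : BlockKernels S U R X₁ X₂ Y₂ Y₃) (n : ℕ) : BlockKernels (Fin n → S) (Fin n → U)
    (Fin n → R) (Fin n → X₁) (Fin n → X₂) (Fin n → Y₂) (Fin n → Y₃) where
  Q := piSimplex fun _ => K.Q
  W x₁ x₂ s := piPairSimplex fun i => K.W (x₁ i) (x₂ i) (s i)
  pU s := piSimplex fun i => K.pU (s i)
  pR u s := piSimplex fun i => K.pR (u i) (s i)
  p₁ u r s := piSimplex fun i => K.p₁ (u i) (r i) (s i)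
  p₂ u s := piSimplex fun i => K.p₂ (u i) (s i)
  q₃ y := piSimplex fun i => K.q₃ (y i)
  q₂ y := piSimplex fun i => K.q₂ (y i)
  qx := piSimplex fun _ => K.qx

/-- Tuples of sequences are sequences of tuples. -/
def zipEquiv (n : ℕ) : ((Fin n → S) × (Fin n → U) × (Fin n → R) × (Fin n → X₁) × (Fin n → X₂) ×
    ((Fin n → Y₂) × (Fin n → Y₃))) ≃ (Fin n → S × U × R × X₁ × X₂ × (Y₂ × Y₃)) where
  toFun z i := (z.1 i, z.2.1 i, z.2.2.1 i, z.2.2.2.1 i, z.2.2.2.2.1 i, z.2.2.2.2.2.1 i,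
    z.2.2.2.2.2.2 i)
  invFun z := (fun i => (z i).1, fun i => (z i).2.1, fun i => (z i).2.2.1, fun i => (z i).2.2.2.1,
    fun i => (z i).2.2.2.2.1, fun i => (z i).2.2.2.2.2.1, fun i => (z i).2.2.2.2.2.2)
  left_inv _ := rfl
  right_inv _ := rfl

theorem power_law (K : BlockKernels S U R X₁ X₂ Y₂ Y₃) (n : ℕ)
    (z : Fin n → S × U × R × X₁ × X₂ × (Y₂ × Y₃)) :
    (K.power n).law ((zipEquiv n).symm z) = ∏ i, K.law (z i) := by
  simp only [InputKernels.law, Finset.prod_mul_distrib]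
  rfl

/-- The one-shot theorem on alphabets of sequences, where products of kernels are again kernels. -/
theorem hasBlockCode (K : BlockKernels S U R X₁ X₂ Y₂ Y₃) {T M T' : Type*} [Fintype T] [Fintype M]
    [Fintype T'] [Nonempty T] [Nonempty M] (ν : stdSimplex ℝ T') (n : ℕ) :
    HasBlockCode K.Q K.W T M ν n (∑ z, (K.power n).law z *
      (K.power n).penalty (Fintype.card M) (Fintype.card T) (Fintype.card T') z) :=
  (K.power n).exists_block_code ν

variable (K : BlockKernels S U R X₁ X₂ Y₂ Y₃)

/-- The number of messages enters as the factor `1 / m n` on the decoding metric, so the rate `ρ`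
counts against decoding. -/
theorem tendsto_destination {ρ : ℝ} {m : ℕ → ℝ}
    (hq : ∀ z, K.law z ≠ 0 → 0 < (K.q₃ z.2.2.2.2.2.2).1 z.2.1)
    (h : ∑ z, K.law z * Real.logb 2 ((K.pU z.1).1 z.2.1 / (K.q₃ z.2.2.2.2.2.2).1 z.2.1) + ρ < 0)
    (hm1 : ∀ n, 1 ≤ m n) (hm : ∀ n : ℕ, m n ≤ 2 * 2 ^ ((n : ℝ) * ρ)) :
    Tendsto (fun n : ℕ => ∑ z, (K.power n).law z * mismatch (((K.power n).pU z.1).1 z.2.1)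
      (((K.power n).q₃ z.2.2.2.2.2.2).1 z.2.1 / m n)) atTop (𝓝 0) := by
  refine (tendsto_sum_mismatch (p := K.law) (P := fun z => (K.pU z.1).1 z.2.1)
    (Q := fun z => (K.q₃ z.2.2.2.2.2.2).1 z.2.1) K.law_nonneg K.sum_law (fun z hz => ?_) hq
    (fun z => stdSimplex_le_one _ _) h (a := fun _ => 1) (b := fun n => 1 / m n)
    (fun _ => zero_le_one) (fun n => one_div_pos.2 (one_pos.trans_le (hm1 n)))
    (fun n => div_le_one_of_le₀ (hm1 n) (zero_le_one.trans (hm1 n))) (fun n => ?_)).congr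
    fun n => ?_
  · refine ((K.pU z.1).2.1 _).lt_of_ne' fun h0 => hz ?_
    simp only [InputKernels.law, h0]; ring
  · rw [mul_one_div, le_div_iff₀ (one_pos.trans_le (hm1 n)), one_mul]
    exact hm n
  · rw [← (zipEquiv n).symm.sum_comp]
    refine Finset.sum_congr rfl fun z _ => ?_
    rw [power_law, one_mul, one_div_mul_eq_div]
    rfl

theorem tendsto_relay {ρ : ℝ} {m : ℕ → ℝ}
    (hq : ∀ z, K.law z ≠ 0 → 0 < (K.q₂ z.2.2.2.2.2.1).1 z.2.2.1)
    (h : ∑ z, K.law z * Real.logb 2 ((K.pR z.2.1 z.1).1 z.2.2.1 /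
      (K.q₂ z.2.2.2.2.2.1).1 z.2.2.1) + ρ < 0)
    (hm1 : ∀ n, 1 ≤ m n) (hm : ∀ n : ℕ, m n ≤ 2 * 2 ^ ((n : ℝ) * ρ)) :
    Tendsto (fun n : ℕ => ∑ z, (K.power n).law z * mismatch (((K.power n).pR z.2.1 z.1).1 z.2.2.1)
      (((K.power n).q₂ z.2.2.2.2.2.1).1 z.2.2.1 / m n)) atTop (𝓝 0) := by
  refine (tendsto_sum_mismatch (p := K.law) (P := fun z => (K.pR z.2.1 z.1).1 z.2.2.1)
    (Q := fun z => (K.q₂ z.2.2.2.2.2.1).1 z.2.2.1) K.law_nonneg K.sum_law (fun z hz => ?_) hq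
    (fun z => stdSimplex_le_one _ _) h (a := fun _ => 1) (b := fun n => 1 / m n)
    (fun _ => zero_le_one) (fun n => one_div_pos.2 (one_pos.trans_le (hm1 n)))
    (fun n => div_le_one_of_le₀ (hm1 n) (zero_le_one.trans (hm1 n))) (fun n => ?_)).congr
    fun n => ?_
  · refine ((K.pR z.2.1 z.1).2.1 _).lt_of_ne' fun h0 => hz ?_
    simp only [InputKernels.law, h0]; ring
  · rw [mul_one_div, le_div_iff₀ (one_pos.trans_le (hm1 n)), one_mul]
    exact hm n
  · rw [← (zipEquiv n).symm.sum_comp]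
    refine Finset.sum_congr rfl fun z _ => ?_
    rw [power_law, one_mul, one_div_mul_eq_div]
    rfl

/-- In contrast with decoding, more indices help: `1 / t n` multiplies the selecting distribution,
hence the exponent `-ρ`. -/
theorem tendsto_description {ρ : ℝ} {t : ℕ → ℝ}
    (hq : ∀ z, K.law z ≠ 0 → 0 < K.qx.1 z.2.2.2.2.1)
    (h : ∑ z, K.law z * Real.logb 2 ((K.p₂ z.2.1 z.1).1 z.2.2.2.2.1 / K.qx.1 z.2.2.2.2.1) < ρ)
    (ht : ∀ n : ℕ, 2 ^ ((n : ℝ) * ρ) ≤ t n) :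
    Tendsto (fun n : ℕ => ∑ z, (K.power n).law z *
      mismatch (((K.power n).p₂ z.2.1 z.1).1 z.2.2.2.2.1 / t n)
      ((K.power n).qx.1 z.2.2.2.2.1)) atTop (𝓝 0) := by
  have ht0 : ∀ n, 0 < t n := fun n => (Real.rpow_pos_of_pos two_pos _).trans_le (ht n)
  refine (tendsto_sum_mismatch (p := K.law) (P := fun z => (K.p₂ z.2.1 z.1).1 z.2.2.2.2.1)
    (Q := fun z => K.qx.1 z.2.2.2.2.1) (R := -ρ) K.law_nonneg K.sum_law (fun z hz => ?_) hq
    (fun z => stdSimplex_le_one _ _) (by linarith) (a := fun n => 1 / t n) (b := fun _ => 1)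
    (fun n => (one_div_pos.2 (ht0 n)).le) (fun n => one_pos) (fun n => le_rfl)
    (fun n => ?_)).congr fun n => ?_
  · refine ((K.p₂ z.2.1 z.1).2.1 _).lt_of_ne' fun h0 => hz ?_
    simp only [InputKernels.law, h0]; ring
  · rw [mul_neg, Real.rpow_neg two_pos.le, mul_one]
    have h2 := Real.rpow_pos_of_pos two_pos ((n : ℝ) * ρ)
    refine (one_div_le_one_div_of_le h2 (ht n)).trans ?_
    rw [one_div]
    linarith [inv_pos.2 h2]
  · rw [← (zipEquiv n).symm.sum_comp]
    refine Finset.sum_congr rfl fun z _ => ?_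
    rw [power_law, one_mul, one_div_mul_eq_div]
    rfl

end BlockKernels

/-! ### Laws, mutual information and data processing. -/

section InformationLemmas

variable {Ω A B C : Type*} [Fintype Ω] [Fintype A] [Fintype B] [Fintype C]

theorem lawOf_eq_sum_ind {Ω A : Type*} [Fintype Ω] (p : Ω → ℝ) (f : Ω → A) (a : A) :
    lawOf p f a = ∑ ω, p ω * ind (f ω = a) := by
  simp only [lawOf, ind, mul_ite, mul_one, mul_zero]

theorem sum_lawOf_mul (p : Ω → ℝ) (f : Ω → A) (F : A → ℝ) :
    ∑ a, lawOf p f a * F a = ∑ ω, p ω * F (f ω) := by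
  classical
  simp only [lawOf_eq_sum_ind, Finset.sum_mul]
  rw [Finset.sum_comm]
  refine Finset.sum_congr rfl fun ω _ => ?_
  rw [Finset.sum_eq_single (f ω) (fun b _ hb => by rw [ind_of_not (Ne.symm hb)]; ring) (by simp),
    ind_of rfl, mul_one]

theorem sum_lawOf (p : Ω → ℝ) (f : Ω → A) : ∑ a, lawOf p f a = ∑ ω, p ω := by
  simpa using sum_lawOf_mul p f fun _ => 1

theorem lawOf_comp {D : Type*} (p : Ω → ℝ) (f : Ω → A) (g : A → D) :
    lawOf p (fun ω => g (f ω)) = lawOf (lawOf p f) g := by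
  funext d
  rw [lawOf_eq_sum_ind, lawOf_eq_sum_ind, sum_lawOf_mul]

theorem lawOf_nonneg {Ω A : Type*} [Fintype Ω] {p : Ω → ℝ} (hp : ∀ ω, 0 ≤ p ω) (f : Ω → A) (a : A) :
    0 ≤ lawOf p f a := by
  rw [lawOf_eq_sum_ind]
  exact Finset.sum_nonneg fun ω _ => mul_nonneg (hp ω) (ind_nonneg _)

theorem le_lawOf {Ω A : Type*} [Fintype Ω] {p : Ω → ℝ} (hp : ∀ ω, 0 ≤ p ω) (f : Ω → A) (ω : Ω) :
    p ω ≤ lawOf p f (f ω) := by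
  rw [lawOf_eq_sum_ind]
  refine le_trans ?_ (Finset.single_le_sum
    (fun ω _ => mul_nonneg (hp ω) (ind_nonneg (f ω = _))) (mem_univ ω))
  rw [ind_of rfl, mul_one]

theorem lawOf_pos {Ω A : Type*} [Fintype Ω] {p : Ω → ℝ} (hp : ∀ ω, 0 ≤ p ω) (f : Ω → A) {ω : Ω}
    (hω : p ω ≠ 0) : 0 < lawOf p f (f ω) :=
  ((hp ω).lt_of_ne' hω).trans_le (le_lawOf hp f ω)

theorem lawOf_equiv {Ω A D : Type*} [Fintype Ω] (p : Ω → ℝ) (f : Ω → A) (e : A → D)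
    (he : Function.Injective e) (a : A) : lawOf p (fun ω => e (f ω)) (e a) = lawOf p f a := by
  simp only [lawOf_eq_sum_ind, he.eq_iff]

theorem sum_lawOf_pair_left {Ω A B : Type*} [Fintype Ω] [Fintype A] (p : Ω → ℝ) (f : Ω → A)
    (g : Ω → B) (b : B) : ∑ a, lawOf p (fun ω => (f ω, g ω)) (a, b) = lawOf p g b := by
  simp only [lawOf_eq_sum_ind, Prod.mk.injEq, ind_and]
  rw [Finset.sum_comm]
  refine Finset.sum_congr rfl fun ω _ => ?_
  rw [← Finset.mul_sum, ← Finset.sum_mul, sum_ind_eq, one_mul]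

/-- The law of a random variable. -/
noncomputable def lawSimplex (p : stdSimplex ℝ Ω) (f : Ω → A) : stdSimplex ℝ A :=
  ⟨lawOf p.1 f, lawOf_nonneg p.2.1 f, (sum_lawOf p.1 f).trans p.2.2⟩

open Classical in
/-- The conditional law of `f` given `g = b`. -/
noncomputable def condSimplex (p : stdSimplex ℝ Ω) (f : Ω → A) (g : Ω → B) (b : B) :
    stdSimplex ℝ A :=
  -- On null events any distribution would do; the unconditional law is available without further
  -- choice.
  if h : lawOf p.1 g b = 0 then lawSimplex p f else
    ⟨fun a => lawOf p.1 (fun ω => (f ω, g ω)) (a, b) / lawOf p.1 g b,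
      fun _ => div_nonneg (lawOf_nonneg p.2.1 _ _) (lawOf_nonneg p.2.1 _ _), by
      rw [← Finset.sum_div, sum_lawOf_pair_left, div_self h]⟩

theorem condSimplex_apply {Ω A B : Type*} [Fintype Ω] [Fintype A] (p : stdSimplex ℝ Ω) (f : Ω → A) (g : Ω → B) {b : B}
    (h : lawOf p.1 g b ≠ 0) (a : A) :
    (condSimplex p f g b).1 a = lawOf p.1 (fun ω => (f ω, g ω)) (a, b) / lawOf p.1 g b := by
  rw [condSimplex, dif_neg h]

theorem mul_condSimplex {Ω A B : Type*} [Fintype Ω] [Fintype A] (p : stdSimplex ℝ Ω) (f : Ω → A) (g : Ω → B) (a : A) (b : B) :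
    lawOf p.1 g b * (condSimplex p f g b).1 a = lawOf p.1 (fun ω => (f ω, g ω)) (a, b) := by
  by_cases h : lawOf p.1 g b = 0
  · rw [h, zero_mul]
    refine le_antisymm (lawOf_nonneg p.2.1 _ _) (h ▸ ?_)
    rw [← sum_lawOf_pair_left p.1 f g b]
    exact Finset.single_le_sum (f := fun a => lawOf p.1 (fun ω => (f ω, g ω)) (a, b))
      (fun a _ => lawOf_nonneg p.2.1 _ _) (mem_univ a)
  · rw [condSimplex_apply p f g h, mul_div_cancel₀ _ h]

theorem mutualInfo_eq (p : Ω → ℝ) (f : Ω → A) (g : Ω → B) :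
    mutualInfo p f g = ∑ ω, p ω * Real.logb 2 (lawOf p (fun ω => (f ω, g ω)) (f ω, g ω) /
      (lawOf p f (f ω) * lawOf p g (g ω))) := by
  rw [mutualInfo, ← Fintype.sum_prod_type', ← sum_lawOf_mul p (fun ω => (f ω, g ω)) fun z =>
    Real.logb 2 (lawOf p (fun ω => (f ω, g ω)) z / (lawOf p f z.1 * lawOf p g z.2))]

theorem condMutualInfo_eq (p : Ω → ℝ) (f : Ω → A) (g : Ω → B) (h : Ω → C) :
    condMutualInfo p f g h = ∑ ω, p ω * Real.logb 2
      (lawOf p (fun ω => (f ω, g ω, h ω)) (f ω, g ω, h ω) * lawOf p h (h ω) /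
      (lawOf p (fun ω => (f ω, h ω)) (f ω, h ω) * lawOf p (fun ω => (g ω, h ω)) (g ω, h ω))) := by
  rw [condMutualInfo, ← sum_lawOf_mul p (fun ω => (f ω, g ω, h ω)) fun z =>
    Real.logb 2 (lawOf p (fun ω => (f ω, g ω, h ω)) z * lawOf p h z.2.2 /
      (lawOf p (fun ω => (f ω, h ω)) (z.1, z.2.2) * lawOf p (fun ω => (g ω, h ω)) z.2))]
  simp only [Fintype.sum_prod_type]

theorem mutualInfo_comm (p : Ω → ℝ) (f : Ω → A) (g : Ω → B) :
    mutualInfo p f g = mutualInfo p g f := by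
  rw [mutualInfo, mutualInfo, Finset.sum_comm]
  refine Finset.sum_congr rfl fun b _ => Finset.sum_congr rfl fun a _ => ?_
  rw [mul_comm (lawOf p f a), ← lawOf_equiv p (fun ω => (f ω, g ω)) Prod.swap Prod.swap_injective]
  rfl

theorem mutualInfo_lawOf {D : Type*} [Fintype D] (p : Ω → ℝ) (π : Ω → D) (f : D → A) (g : D → B) :
    mutualInfo (lawOf p π) f g = mutualInfo p (fun ω => f (π ω)) fun ω => g (π ω) := by
  simp only [mutualInfo, ← lawOf_comp]

theorem mutualInfo_add_condMutualInfo {p : Ω → ℝ} (hp : ∀ ω, 0 ≤ p ω) (f : Ω → A) (g : Ω → B)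
    (h : Ω → C) : mutualInfo p f h + condMutualInfo p f g h =
      mutualInfo p f fun ω => (g ω, h ω) := by
  rw [mutualInfo_eq, condMutualInfo_eq, mutualInfo_eq, ← Finset.sum_add_distrib]
  refine Finset.sum_congr rfl fun ω _ => ?_
  by_cases hω : p ω = 0
  · simp [hω]
  rw [← mul_add]
  congr 1
  have h1 := lawOf_pos hp (fun ω => (f ω, h ω)) hω
  have h2 := lawOf_pos hp f hω
  have h3 := lawOf_pos hp h hω
  have h4 := lawOf_pos hp (fun ω => (f ω, g ω, h ω)) hω
  have h5 := lawOf_pos hp (fun ω => (g ω, h ω)) hω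
  rw [← Real.logb_mul (by positivity) (by positivity)]
  congr 1
  field_simp

/-- Gibbs' inequality. -/
theorem sum_mul_logb_nonneg {p r : Ω → ℝ} (hp : ∀ ω, 0 ≤ p ω) (hp1 : ∑ ω, p ω = 1)
    (hr : ∀ ω, p ω ≠ 0 → 0 < r ω) (h : ∑ ω, p ω / r ω ≤ 1) :
    0 ≤ ∑ ω, p ω * Real.logb 2 (r ω) ∧
      ((∃ ω, p ω ≠ 0 ∧ r ω ≠ 1) → 0 < ∑ ω, p ω * Real.logb 2 (r ω)) := by
  have hl : 0 < Real.log 2 := Real.log_pos one_lt_two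
  have hle : ∀ ω, (p ω - p ω / r ω) / Real.log 2 ≤ p ω * Real.logb 2 (r ω) := fun ω => by
    by_cases hω : p ω = 0
    · simp [hω]
    have := Real.one_sub_inv_le_log_of_pos (hr ω hω)
    rw [Real.logb, ← mul_div_assoc]
    refine div_le_div_of_nonneg_right ?_ hl.le
    refine le_trans (le_of_eq ?_) (mul_le_mul_of_nonneg_left this (hp ω))
    rw [div_eq_mul_inv]; ring
  have h0 : 0 ≤ ∑ ω, (p ω - p ω / r ω) / Real.log 2 := by
    rw [← Finset.sum_div, Finset.sum_sub_distrib, hp1]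
    exact div_nonneg (by linarith) hl.le
  refine ⟨h0.trans (Finset.sum_le_sum fun ω _ => hle ω), ?_⟩
  rintro ⟨ω, hω, hr1⟩
  refine h0.trans_lt (Finset.sum_lt_sum (fun ω _ => hle ω) ⟨ω, mem_univ ω, ?_⟩)
  have hrω := hr ω hω
  have hpω := (hp ω).lt_of_ne' hω
  have := Real.log_lt_sub_one_of_pos (inv_pos.2 hrω) (by simpa using hr1)
  rw [Real.log_inv] at this
  rw [Real.logb, ← mul_div_assoc]
  refine div_lt_div_of_pos_right ?_ hl
  have h3 := mul_lt_mul_of_pos_left this hpω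
  rw [div_eq_mul_inv]
  linarith

/-- Gibbs' inequality for the joint law against the product of its marginals. The strict part
provides the positive rate of the starting phase. -/
theorem mutualInfo_nonneg_and_pos {p : Ω → ℝ} (hp : ∀ ω, 0 ≤ p ω) (hp1 : ∑ ω, p ω = 1)
    (f : Ω → A) (g : Ω → B) : 0 ≤ mutualInfo p f g ∧
      ((∃ a b, lawOf p (fun ω => (f ω, g ω)) (a, b) ≠ 0 ∧
        lawOf p (fun ω => (f ω, g ω)) (a, b) ≠ lawOf p f a * lawOf p g b) →
        0 < mutualInfo p f g) := by
  set q := lawOf p fun ω => (f ω, g ω) with hq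
  have hq0 : ∀ z, 0 ≤ q z := lawOf_nonneg hp _
  have hpos : ∀ a b, q (a, b) ≠ 0 → 0 < lawOf p f a ∧ 0 < lawOf p g b := fun a b hab => by
    rw [hq, lawOf_eq_sum_ind] at hab
    obtain ⟨ω, -, hω⟩ := Finset.exists_ne_zero_of_sum_ne_zero hab
    have h1 := left_ne_zero_of_mul hω
    have h2 : (f ω, g ω) = (a, b) := by
      by_contra h; exact right_ne_zero_of_mul hω (ind_of_not h)
    obtain ⟨rfl, rfl⟩ := Prod.mk.inj h2
    exact ⟨lawOf_pos hp f h1, lawOf_pos hp g h1⟩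
  have key := sum_mul_logb_nonneg (p := q) (r := fun z => q z / (lawOf p f z.1 * lawOf p g z.2))
    hq0 ((sum_lawOf p _).trans hp1)
    (fun z hz => div_pos ((hq0 z).lt_of_ne' hz) (mul_pos (hpos z.1 z.2 hz).1 (hpos z.1 z.2 hz).2))
    (by
      refine (Finset.sum_le_sum (g := fun z : A × B => lawOf p f z.1 * lawOf p g z.2)
        fun z _ => ?_).trans ?_
      · by_cases hz : q z = 0
        · simp only [hz, zero_div]
          exact mul_nonneg (lawOf_nonneg hp _ _) (lawOf_nonneg hp _ _)
        · rw [div_div_cancel₀ hz]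
      · rw [Fintype.sum_prod_type, ← Finset.sum_mul_sum, sum_lawOf, sum_lawOf, hp1, one_mul])
  have hI : mutualInfo p f g =
      ∑ z, q z * Real.logb 2 (q z / (lawOf p f z.1 * lawOf p g z.2)) := by
    rw [mutualInfo, Fintype.sum_prod_type]
  rw [hI]
  refine ⟨key.1, fun ⟨a, b, h1, h2⟩ => key.2 ⟨(a, b), h1, fun h => h2 ?_⟩⟩
  obtain ⟨h3, h4⟩ := hpos a b h1
  exact (div_eq_one_iff_eq (mul_pos h3 h4).ne').1 h

/-- The data processing inequality. -/
theorem mutualInfo_le_of_markov {p : Ω → ℝ} (hp : ∀ ω, 0 ≤ p ω) (hp1 : ∑ ω, p ω = 1)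
    (f : Ω → A) (g : Ω → B) (h : Ω → C) (hm : ∀ a b c,
      lawOf p (fun ω => (f ω, g ω, h ω)) (a, b, c) * lawOf p g b =
        lawOf p (fun ω => (f ω, g ω)) (a, b) * lawOf p (fun ω => (g ω, h ω)) (b, c)) :
    mutualInfo p f h ≤ mutualInfo p f g := by
  set r : Ω → ℝ := fun ω => lawOf p (fun ω => (f ω, g ω)) (f ω, g ω) * lawOf p h (h ω) /
    (lawOf p g (g ω) * lawOf p (fun ω => (f ω, h ω)) (f ω, h ω)) with hr
  have hsub : mutualInfo p f g - mutualInfo p f h = ∑ ω, p ω * Real.logb 2 (r ω) := by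
    rw [mutualInfo_eq, mutualInfo_eq, ← Finset.sum_sub_distrib]
    refine Finset.sum_congr rfl fun ω _ => ?_
    by_cases hω : p ω = 0
    · simp [hω]
    rw [← mul_sub]
    congr 1
    have h1 := lawOf_pos hp (fun ω => (f ω, h ω)) hω
    have h2 := lawOf_pos hp f hω
    have h3 := lawOf_pos hp h hω
    have h4 := lawOf_pos hp (fun ω => (f ω, g ω)) hω
    have h5 := lawOf_pos hp g hω
    rw [← Real.logb_div (by positivity) (by positivity)]
    congr 1
    simp only [hr]
    field_simp
  -- By the Markov property the terms become the law of `(g, h)` times the conditional law of `f`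
  -- given `h`, whose total is at most one; cells where `(f, g)` has probability zero are only lost
  -- on the left.
  have hle : ∑ ω, p ω / r ω ≤ 1 := by
    calc ∑ ω, p ω / r ω = ∑ z : A × B × C, lawOf p (fun ω => (f ω, g ω, h ω)) z *
          (lawOf p (fun ω => (f ω, g ω)) (z.1, z.2.1) * lawOf p h z.2.2 /
          (lawOf p g z.2.1 * lawOf p (fun ω => (f ω, h ω)) (z.1, z.2.2)))⁻¹ := by
          rw [sum_lawOf_mul]
          rfl
      _ ≤ ∑ z : A × B × C, lawOf p (fun ω => (g ω, h ω)) z.2 *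
            lawOf p (fun ω => (f ω, h ω)) (z.1, z.2.2) / lawOf p h z.2.2 := by
          refine Finset.sum_le_sum fun z _ => ?_
          obtain ⟨a, b, c⟩ := z
          simp only
          have n1 := lawOf_nonneg hp (fun ω => (g ω, h ω)) (b, c)
          have n2 := lawOf_nonneg hp (fun ω => (f ω, h ω)) (a, c)
          have n3 := lawOf_nonneg hp h c
          by_cases h0 : lawOf p (fun ω => (f ω, g ω)) (a, b) = 0
          · rw [h0, zero_mul, zero_div, inv_zero, mul_zero]
            positivity
          · rw [inv_div, mul_div_assoc', ← mul_assoc, hm a b c, mul_assoc, mul_div_mul_left _ _ h0]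
      _ = ∑ c, ∑ b, ∑ a, lawOf p (fun ω => (g ω, h ω)) (b, c) *
            lawOf p (fun ω => (f ω, h ω)) (a, c) / lawOf p h c := by
          simp only [Fintype.sum_prod_type]
          rw [Finset.sum_comm]
          rw [Finset.sum_comm (γ := C)]
          refine Finset.sum_congr rfl fun b _ => ?_
          rw [Finset.sum_comm]
      _ ≤ ∑ c, lawOf p h c := by
          refine Finset.sum_le_sum fun c _ => ?_
          simp only [← Finset.sum_div, ← Finset.mul_sum, ← Finset.sum_mul, sum_lawOf_pair_left]
          rw [mul_self_div_self]
      _ = 1 := (sum_lawOf p h).trans hp1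
  have := (sum_mul_logb_nonneg hp hp1 (fun ω hω => ?_) hle).1
  · linarith
  · exact div_pos (mul_pos (lawOf_pos hp (fun ω => (f ω, g ω)) hω) (lawOf_pos hp h hω))
      (mul_pos (lawOf_pos hp g hω) (lawOf_pos hp (fun ω => (f ω, h ω)) hω))

end InformationLemmas

/-! ### Posterior decoding metrics and their information rates. -/

namespace InputKernels

section Variables

variable {S U R X₁ X₂ Y₂ Y₃ : Type*}

/-- The state. -/
abbrev outS (z : S × U × R × X₁ × X₂ × (Y₂ × Y₃)) : S := z.1
/-- The auxiliary variable decoded by the destination. -/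
abbrev outU (z : S × U × R × X₁ × X₂ × (Y₂ × Y₃)) : U := z.2.1
/-- The auxiliary variable decoded by the relay. -/
abbrev outR (z : S × U × R × X₁ × X₂ × (Y₂ × Y₃)) : R := z.2.2.1
/-- The relay input. -/
abbrev outX₂ (z : S × U × R × X₁ × X₂ × (Y₂ × Y₃)) : X₂ := z.2.2.2.2.1
/-- The relay output. -/
abbrev outY₂ (z : S × U × R × X₁ × X₂ × (Y₂ × Y₃)) : Y₂ := z.2.2.2.2.2.1
/-- The destination output. -/
abbrev outY₃ (z : S × U × R × X₁ × X₂ × (Y₂ × Y₃)) : Y₃ := z.2.2.2.2.2.2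

end Variables

variable {S U R X₁ X₂ Y₂ Y₃ : Type*} [Fintype S] [Fintype U] [Fintype R]
    [Fintype X₁] [Fintype X₂] [Fintype Y₂] [Fintype Y₃] (K : InputKernels S U R X₁ X₂ Y₂ Y₃)

/-- The joint law as a distribution. -/
def lawS : stdSimplex ℝ (S × U × R × X₁ × X₂ × (Y₂ × Y₃)) := ⟨K.law, K.law_nonneg, K.sum_law⟩

/-- Decoding by the conditional laws of the auxiliary variables. -/
noncomputable def tuned : BlockKernels S U R X₁ X₂ Y₂ Y₃ where
  toInputKernels := K
  q₃ := condSimplex K.lawS outU outY₃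
  q₂ := condSimplex K.lawS outR outY₂
  qx := lawSimplex K.lawS outX₂

/-- Source input and outputs sum out; indicator functions `F` then give the marginals that follow.
-/
theorem sum_law_mul (F : S → U → R → X₂ → ℝ) :
    ∑ z, K.law z * F (outS z) (outU z) (outR z) (outX₂ z) = ∑ s, ∑ u, ∑ r, ∑ x₂,
      K.Q.1 s * (K.pU s).1 u * (K.pR u s).1 r * (K.p₂ u s).1 x₂ * F s u r x₂ := by
  simp only [Fintype.sum_prod_type (α₁ := S), Fintype.sum_prod_type (α₁ := U),
    Fintype.sum_prod_type (α₁ := R), Fintype.sum_prod_type (α₁ := X₁),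
    Fintype.sum_prod_type (α₁ := X₂), law]
  refine Finset.sum_congr rfl fun s _ => Finset.sum_congr rfl fun u _ =>
    Finset.sum_congr rfl fun r _ => ?_
  rw [Finset.sum_comm]
  refine Finset.sum_congr rfl fun x₂ _ => ?_
  have : ∀ x₁ y, K.Q.1 s * (K.pU s).1 u * (K.pR u s).1 r * (K.p₁ u r s).1 x₁ * (K.p₂ u s).1 x₂ *
      (K.W x₁ x₂ s).1 y * F s u r x₂ = K.Q.1 s * (K.pU s).1 u * (K.pR u s).1 r * (K.p₂ u s).1 x₂ *
        F s u r x₂ * (K.p₁ u r s).1 x₁ * (K.W x₁ x₂ s).1 y := fun x₁ y => by ring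
  simp only [this, ← Finset.mul_sum, (K.W _ _ _).2.2, mul_one, (K.p₁ _ _ _).2.2]

theorem sum_mul_ind {A : Type*} [Fintype A] (b : A) (F : A → ℝ) : ∑ a, F a * ind (a = b) = F b := by
  classical
  simp [ind]

theorem lawOf_state (s : S) : lawOf K.law outS s = K.Q.1 s := by
  rw [lawOf_eq_sum_ind, K.sum_law_mul fun s' _ _ _ => ind (s' = s)]
  simp only [← Finset.sum_mul, ← Finset.mul_sum, (K.p₂ _ _).2.2, (K.pR _ _).2.2, (K.pU _).2.2,
    mul_one, sum_mul_ind]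

theorem lawOf_auxiliary_state (u : U) (s : S) :
    lawOf K.law (fun z => (outU z, outS z)) (u, s) = K.Q.1 s * (K.pU s).1 u := by
  simp only [lawOf_eq_sum_ind, Prod.mk.injEq]
  rw [K.sum_law_mul fun s' u' _ _ => ind (u' = u ∧ s' = s)]
  simp only [ind_and, ← mul_assoc, ← Finset.sum_mul, ← Finset.mul_sum, (K.p₂ _ _).2.2,
    (K.pR _ _).2.2, mul_one, sum_mul_ind]

theorem lawOf_relay_auxiliary_state (r : R) (u : U) (s : S) :
    lawOf K.law (fun z => (outR z, outU z, outS z)) (r, u, s) =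
      K.Q.1 s * (K.pU s).1 u * (K.pR u s).1 r := by
  simp only [lawOf_eq_sum_ind, Prod.mk.injEq]
  rw [K.sum_law_mul fun s' u' r' _ => ind (r' = r ∧ u' = u ∧ s' = s)]
  simp only [ind_and, ← mul_assoc, ← Finset.sum_mul, (K.p₂ _ _).2.2, ← Finset.mul_sum, mul_one,
    sum_mul_ind]

theorem lawOf_input_auxiliary_state (x : X₂) (u : U) (s : S) :
    lawOf K.law (fun z => (outX₂ z, outU z, outS z)) (x, u, s) =
      K.Q.1 s * (K.pU s).1 u * (K.p₂ u s).1 x := by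
  simp only [lawOf_eq_sum_ind, Prod.mk.injEq]
  rw [K.sum_law_mul fun s' u' _ x' => ind (x' = x ∧ u' = u ∧ s' = s)]
  have : ∀ s' u' r' x', K.Q.1 s' * (K.pU s').1 u' * (K.pR u' s').1 r' * (K.p₂ u' s').1 x' *
      ind (x' = x ∧ u' = u ∧ s' = s) = K.Q.1 s' * (K.pU s').1 u' * (K.p₂ u' s').1 x' *
      ind (x' = x) * ind (u' = u) * ind (s' = s) * (K.pR u' s').1 r' := fun s' u' r' x' => by
    rw [ind_and, ind_and]; ring
  simp only [this]
  simp only [← Finset.mul_sum, (K.pR _ _).2.2, mul_one,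
    ← Finset.sum_mul, sum_mul_ind]

theorem tuned_destination_pos (z) (hz : K.law z ≠ 0) :
    0 < (K.tuned.q₃ (outY₃ z)).1 (outU z) := by
  have h := lawOf_pos K.law_nonneg outY₃ hz
  simp only [tuned]
  rw [condSimplex_apply _ _ _ h.ne']
  exact div_pos (lawOf_pos K.law_nonneg (fun z => (outU z, outY₃ z)) hz) h

theorem tuned_relay_pos (z) (hz : K.law z ≠ 0) :
    0 < (K.tuned.q₂ (outY₂ z)).1 (outR z) := by
  have h := lawOf_pos K.law_nonneg outY₂ hz
  simp only [tuned]
  rw [condSimplex_apply _ _ _ h.ne']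
  exact div_pos (lawOf_pos K.law_nonneg (fun z => (outR z, outY₂ z)) hz) h

theorem tuned_input_pos (z) (hz : K.law z ≠ 0) : 0 < K.tuned.qx.1 (outX₂ z) :=
  lawOf_pos K.law_nonneg outX₂ hz

/-- With the posterior as decoding metric both conditional laws can be divided by the law of `U`,
which turns the expected log-ratio into a difference of informations. -/
theorem sum_logb_destination : ∑ z, K.law z *
    Real.logb 2 ((K.pU (outS z)).1 (outU z) / (K.tuned.q₃ (outY₃ z)).1 (outU z)) =
      mutualInfo K.law outU outS - mutualInfo K.law outU outY₃ := by
  rw [mutualInfo_eq, mutualInfo_eq, ← Finset.sum_sub_distrib]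
  refine Finset.sum_congr rfl fun z _ => ?_
  by_cases hz : K.law z = 0
  · simp [hz]
  rw [← mul_sub]
  congr 1
  have hp := K.law_nonneg
  have h1 := lawOf_pos hp (fun z => (outU z, outS z)) hz
  have h2 := lawOf_pos hp (fun z => (outU z, outY₃ z)) hz
  have h3 := lawOf_pos hp outY₃ hz
  have h4 := lawOf_pos hp outU hz
  have h5 := lawOf_pos hp outS hz
  have e1 : (K.pU (outS z)).1 (outU z) = lawOf K.law (fun z => (outU z, outS z)) (outU z, outS z) /
      lawOf K.law outS (outS z) := by
    rw [eq_div_iff h5.ne', lawOf_auxiliary_state, lawOf_state, mul_comm]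
  simp only [tuned]
  rw [condSimplex_apply _ _ _ h3.ne', e1, ← Real.logb_div (by positivity) (by positivity)]
  congr 1
  simp only [lawS]
  field_simp

theorem sum_logb_relay : ∑ z, K.law z *
    Real.logb 2 ((K.pR (outU z) (outS z)).1 (outR z) / (K.tuned.q₂ (outY₂ z)).1 (outR z)) =
      mutualInfo K.law outR (fun z => (outU z, outS z)) - mutualInfo K.law outR outY₂ := by
  rw [mutualInfo_eq, mutualInfo_eq, ← Finset.sum_sub_distrib]
  refine Finset.sum_congr rfl fun z _ => ?_
  by_cases hz : K.law z = 0
  · simp [hz]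
  rw [← mul_sub]
  congr 1
  have hp := K.law_nonneg
  have h1 := lawOf_pos hp (fun z => (outR z, outU z, outS z)) hz
  have h2 := lawOf_pos hp (fun z => (outR z, outY₂ z)) hz
  have h3 := lawOf_pos hp outY₂ hz
  have h4 := lawOf_pos hp outR hz
  have h5 := lawOf_pos hp (fun z => (outU z, outS z)) hz
  have e1 : (K.pR (outU z) (outS z)).1 (outR z) =
      lawOf K.law (fun z => (outR z, outU z, outS z)) (outR z, outU z, outS z) /
      lawOf K.law (fun z => (outU z, outS z)) (outU z, outS z) := by
    rw [eq_div_iff h5.ne', lawOf_relay_auxiliary_state, lawOf_auxiliary_state, mul_comm]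
  simp only [tuned]
  rw [condSimplex_apply _ _ _ h3.ne', e1, ← Real.logb_div (by positivity) (by positivity)]
  congr 1
  simp only [lawS]
  field_simp

theorem sum_logb_input : ∑ z, K.law z *
    Real.logb 2 ((K.p₂ (outU z) (outS z)).1 (outX₂ z) / K.tuned.qx.1 (outX₂ z)) =
      mutualInfo K.law outX₂ fun z => (outU z, outS z) := by
  rw [mutualInfo_eq]
  refine Finset.sum_congr rfl fun z _ => ?_
  by_cases hz : K.law z = 0
  · simp [hz]
  congr 2
  have h5 := lawOf_pos K.law_nonneg (fun z => (outU z, outS z)) hz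
  have h4 := lawOf_pos K.law_nonneg outX₂ hz
  have e1 : (K.p₂ (outU z) (outS z)).1 (outX₂ z) =
      lawOf K.law (fun z => (outX₂ z, outU z, outS z)) (outX₂ z, outU z, outS z) /
      lawOf K.law (fun z => (outU z, outS z)) (outU z, outS z) := by
    rw [eq_div_iff h5.ne', lawOf_input_auxiliary_state, lawOf_auxiliary_state, mul_comm]
  rw [e1]
  simp only [tuned, lawSimplex, lawS]
  field_simp

end InputKernels

/-! ### Markov chains from factorizations. -/

section Markov

variable {Ω A B C : Type*} [Fintype Ω] [Fintype A] [Fintype B] [Fintype C]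

theorem sum_lawOf_triple_right {Ω A B C : Type*} [Fintype Ω] [Fintype C] (p : Ω → ℝ) (f : Ω → A)
    (g : Ω → B) (h : Ω → C) (a : A) (b : B) :
    ∑ c, lawOf p (fun ω => (f ω, g ω, h ω)) (a, b, c) = lawOf p (fun ω => (f ω, g ω)) (a, b) := by
  simp only [lawOf_eq_sum_ind, Prod.mk.injEq, ind_and]
  rw [Finset.sum_comm]
  refine Finset.sum_congr rfl fun ω _ => ?_
  simp only [← Finset.mul_sum, sum_ind_eq, mul_one]

theorem lawOf_congr {Ω A : Type*} [Fintype Ω] {p : Ω → ℝ} {f g : Ω → A}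
    (h : ∀ ω, p ω ≠ 0 → f ω = g ω) : lawOf p f = lawOf p g := by
  funext a
  simp only [lawOf_eq_sum_ind]
  refine Finset.sum_congr rfl fun ω _ => ?_
  by_cases hω : p ω = 0
  · simp [hω]
  · rw [h ω hω]

/-- Factorization of the joint law implies the data processing inequality. -/
theorem mutualInfo_le_of_factor {p : Ω → ℝ} (hp : ∀ ω, 0 ≤ p ω) (hp1 : ∑ ω, p ω = 1)
    (f : Ω → A) (g : Ω → B) (h : Ω → C) (α : A → B → ℝ) (κ : B → C → ℝ)
    (hm : ∀ a b c, lawOf p (fun ω => (f ω, g ω, h ω)) (a, b, c) = α a b * κ b c) :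
    mutualInfo p f h ≤ mutualInfo p f g := by
  have h1 : ∀ a b, lawOf p (fun ω => (f ω, g ω)) (a, b) = α a b * ∑ c, κ b c := fun a b => by
    rw [← sum_lawOf_triple_right p f g h, Finset.mul_sum]
    exact Finset.sum_congr rfl fun c _ => hm a b c
  have h2 : ∀ b c, lawOf p (fun ω => (g ω, h ω)) (b, c) = (∑ a, α a b) * κ b c := fun b c => by
    rw [← sum_lawOf_pair_left p f, Finset.sum_mul]
    exact Finset.sum_congr rfl fun a _ => hm a b c
  have h3 : ∀ b, lawOf p g b = (∑ a, α a b) * ∑ c, κ b c := fun b => by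
    rw [← sum_lawOf_pair_left p f, Finset.sum_mul]
    exact Finset.sum_congr rfl fun a _ => h1 a b
  refine mutualInfo_le_of_markov hp hp1 f g h fun a b c => ?_
  rw [hm, h1, h2, h3]
  ring

/-- The output law of a channel `k` with input law `p`. -/
def mixSimplex (p : stdSimplex ℝ A) (k : A → stdSimplex ℝ B) : stdSimplex ℝ B :=
  ⟨fun b => ∑ a, p.1 a * (k a).1 b,
    fun b => Finset.sum_nonneg fun a _ => mul_nonneg (p.2.1 a) ((k a).2.1 b), by
    rw [Finset.sum_comm]
    simp only [← Finset.mul_sum, (k _).2.2, mul_one, p.2.2]⟩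

end Markov

/-! ### Elimination of `X` and `X̂`. -/

namespace AnalogInput

variable {S U UR X₁ X₂ X Y₂ Y₃ : Type*} [Fintype S] [Fintype U] [Fintype UR] [Fintype X₁]
  [Fintype X₂] [Fintype X] [Fintype Y₂] [Fintype Y₃]

/-- The random variable `X₂`. -/
def rvX₂ : AnalogOutcome S U UR X₁ X₂ X Y₂ Y₃ → X₂ := fun (_, _, _, _, x₂, _, _, _, _) => x₂

/-- The random variables other than `X` and `X̂`. -/
def rvRest : AnalogOutcome S U UR X₁ X₂ X Y₂ Y₃ → S × U × UR × X₁ × X₂ × (Y₂ × Y₃) :=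
  fun (s, u, ur, x₁, x₂, _, _, y₂, y₃) => (s, u, ur, x₁, x₂, y₂, y₃)

variable (P : AnalogInput S U UR X₁ X₂ X) (Q : stdSimplex ℝ S)
    (W : X₁ → X₂ → S → stdSimplex ℝ (Y₂ × Y₃))

/-- The input distributions without `X` and `X̂`. -/
noncomputable def kernels : InputKernels S U UR X₁ X₂ Y₂ Y₃ where
  Q := Q
  W := W
  pU s := lawSimplex (P.pU s) Prod.fst
  pR u s := condSimplex (P.pU s) Prod.snd Prod.fst u
  p₁ := P.pX₁
  p₂ u s := mixSimplex (P.pX u s) P.pXhat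

theorem pU_eq (s : S) (u : U) (r : UR) :
    (P.pU s).1 (u, r) = ((P.kernels Q W).pU s).1 u * ((P.kernels Q W).pR u s).1 r := by
  simp only [kernels, lawSimplex]
  rw [mul_condSimplex, ← lawOf_equiv _ _ Prod.swap Prod.swap_injective, lawOf_eq_sum_ind]
  exact (InputKernels.sum_mul_ind (u, r) (P.pU s).1).symm

theorem law_nonneg (ω) : 0 ≤ P.law Q W ω := by
  obtain ⟨s, u, ur, x₁, x₂, x, xhat, y₂, y₃⟩ := ω
  simp only [law]
  refine mul_nonneg (mul_nonneg (mul_nonneg (mul_nonneg (mul_nonneg (mul_nonneg (Q.2.1 _)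
    ((P.pU _).2.1 _)) ((P.pX₁ _ _ _).2.1 _)) ((P.pX _ _).2.1 _)) ((P.pXhat _).2.1 _)) ?_)
    ((W _ _ _).2.1 _)
  split_ifs <;> norm_num

theorem rvXhat_eq {ω} (h : P.law Q W ω ≠ 0) : rvXhat ω = rvX₂ ω := by
  obtain ⟨s, u, ur, x₁, x₂, x, xhat, y₂, y₃⟩ := ω
  by_contra hne
  have : x₂ ≠ xhat := fun e => hne e.symm
  exact h (by simp [law, this])

theorem sum_law_mul (F : S × U × UR × X₁ × X₂ × (Y₂ × Y₃) → X → ℝ) :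
    ∑ ω, P.law Q W ω * F (rvRest ω) (rvX ω) =
      ∑ s, ∑ u, ∑ r, ∑ x₁, ∑ x₂, ∑ x, ∑ y, Q.1 s * ((P.kernels Q W).pU s).1 u *
        ((P.kernels Q W).pR u s).1 r * (P.pX₁ u r s).1 x₁ * ((P.pX u s).1 x * (P.pXhat x).1 x₂) *
        (W x₁ x₂ s).1 y * F (s, u, r, x₁, x₂, y) x := by
  classical
  simp only [Fintype.sum_prod_type, rvRest, rvX, law, P.pU_eq Q W]
  refine Finset.sum_congr rfl fun s _ => Finset.sum_congr rfl fun u _ =>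
    Finset.sum_congr rfl fun r _ => Finset.sum_congr rfl fun x₁ _ =>
    Finset.sum_congr rfl fun x₂ _ => Finset.sum_congr rfl fun x _ => ?_
  rw [Finset.sum_eq_single x₂ (fun xh _ hx => by simp [Ne.symm hx]) (by simp)]
  refine Finset.sum_congr rfl fun y₂ _ => Finset.sum_congr rfl fun y₃ _ => ?_
  rw [if_pos rfl]
  ring

/-- Summing over `X` and over `X̂ = X₂` composes `P_{X|U,S}` with `P_{X̂|X}`, which is the kernel
`p₂`. -/
theorem lawOf_rest : lawOf (P.law Q W) rvRest = (P.kernels Q W).law := by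
  funext z
  rw [lawOf_eq_sum_ind, P.sum_law_mul Q W fun z' _ => ind (z' = z),
    ← InputKernels.sum_mul_ind z (P.kernels Q W).law]
  simp only [Fintype.sum_prod_type (α₁ := S), Fintype.sum_prod_type (α₁ := U),
    Fintype.sum_prod_type (α₁ := UR), Fintype.sum_prod_type (α₁ := X₁),
    Fintype.sum_prod_type (α₁ := X₂)]
  refine Finset.sum_congr rfl fun s _ => Finset.sum_congr rfl fun u _ =>
    Finset.sum_congr rfl fun r _ => Finset.sum_congr rfl fun x₁ _ =>
    Finset.sum_congr rfl fun x₂ _ => ?_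
  rw [Finset.sum_comm]
  refine Finset.sum_congr rfl fun y _ => ?_
  simp only [InputKernels.law]
  have : ((P.kernels Q W).p₂ u s).1 x₂ = ∑ x, (P.pX u s).1 x * (P.pXhat x).1 x₂ := rfl
  rw [this]
  simp only [Finset.mul_sum, Finset.sum_mul]
  rfl

theorem sum_law : ∑ ω, P.law Q W ω = 1 := by
  rw [← sum_lawOf _ rvRest, lawOf_rest, InputKernels.sum_law]

theorem rate_eq : P.rate Q W =
    mutualInfo (P.kernels Q W).law InputKernels.outU InputKernels.outY₃ -
      mutualInfo (P.kernels Q W).law InputKernels.outU InputKernels.outS := by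
  rw [← lawOf_rest, mutualInfo_lawOf, mutualInfo_lawOf]
  rfl

/-- Data processing: `X₂` equals `X̂` almost surely and depends on `(U, S)` only through `X`. -/
theorem description_le : mutualInfo (P.kernels Q W).law InputKernels.outX₂
    (fun z => (InputKernels.outU z, InputKernels.outS z)) ≤ mutualInfo (P.law Q W) rvX rvXhat := by
  have h1 : mutualInfo (P.law Q W) rvX rvXhat = mutualInfo (P.law Q W) rvX rvX₂ := by
    simp only [mutualInfo]
    rw [lawOf_congr (f := fun ω => (rvX ω, rvXhat ω)) (g := fun ω => (rvX ω, rvX₂ ω))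
      fun ω hω => by rw [P.rvXhat_eq Q W hω], lawOf_congr fun ω hω => P.rvXhat_eq Q W hω]
  rw [h1, mutualInfo_comm _ rvX, ← lawOf_rest, mutualInfo_lawOf]
  refine mutualInfo_le_of_factor (P.law_nonneg Q W) (P.sum_law Q W) rvX₂ rvX
    (fun ω => (InputKernels.outU (rvRest ω), InputKernels.outS (rvRest ω)))
    (fun x₂ x => (P.pXhat x).1 x₂)
    (fun x us => Q.1 us.2 * ((P.kernels Q W).pU us.2).1 us.1 * (P.pX us.1 us.2).1 x) ?_
  rintro x₂ x ⟨u, s⟩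
  rw [lawOf_eq_sum_ind]
  have := P.sum_law_mul Q W fun z x' =>
    ind ((z.2.2.2.2.1, x', z.2.1, z.1) = (x₂, x, u, s))
  refine this.trans ?_
  have hterm : ∀ s' u' r' x₁' x₂' x' y', Q.1 s' * ((P.kernels Q W).pU s').1 u' *
      ((P.kernels Q W).pR u' s').1 r' * (P.pX₁ u' r' s').1 x₁' *
      ((P.pX u' s').1 x' * (P.pXhat x').1 x₂') * (W x₁' x₂' s').1 y' *
      ind ((x₂', x', u', s') = (x₂, x, u, s)) = Q.1 s' * ((P.kernels Q W).pU s').1 u' *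
      ((P.kernels Q W).pR u' s').1 r' * (P.pX₁ u' r' s').1 x₁' *
      ((P.pX u' s').1 x' * (P.pXhat x').1 x₂' * ind (x' = x) * ind (x₂' = x₂) *
        ind (u' = u) * ind (s' = s)) * (W x₁' x₂' s').1 y' := by
    intro s' u' r' x₁' x₂' x' y'
    simp only [Prod.mk.injEq, ind_and]
    ring
  simp only [hterm, ← Finset.mul_sum, (W _ _ _).2.2, mul_one, ← Finset.sum_mul, InputKernels.sum_mul_ind,
    (P.pX₁ _ _ _).2.2, ((P.kernels Q W).pR _ _).2.2]
  simp only [← mul_assoc]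
  simp only [← Finset.sum_mul, InputKernels.sum_mul_ind]
  ring

variable {P Q W}

/-- The chain rule merges `I(U_R;S) + I(U_R;U|S)` into `I(U_R;U,S)`, the cost that the relay's
matching incurs. -/
theorem Feasible.lt (h : P.Feasible Q W) :
    mutualInfo (P.law Q W) rvX rvXhat <
      mutualInfo (P.kernels Q W).law InputKernels.outR InputKernels.outY₂ -
      mutualInfo (P.kernels Q W).law InputKernels.outR
        (fun z => (InputKernels.outU z, InputKernels.outS z)) := by
  rw [Feasible, sub_sub, mutualInfo_add_condMutualInfo (P.law_nonneg Q W)] at h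
  rw [← lawOf_rest, mutualInfo_lawOf, mutualInfo_lawOf]
  exact h

end AnalogInput

/-! ### The starting phase. -/

section Start

variable {S U R X₁ X₂ Y₂ Y₃ : Type*} [Fintype S] [Fintype U] [Fintype R]
    [Fintype X₁] [Fintype X₂] [Fintype Y₂] [Fintype Y₃]

/-- The law of the relay output. -/
def relayOutput (W : X₁ → X₂ → S → stdSimplex ℝ (Y₂ × Y₃)) (x₁ : X₁) (x₂ : X₂) (s : S) (y₂ : Y₂) :
    ℝ := ∑ y₃, (W x₁ x₂ s).1 (y₂, y₃)

namespace InputKernels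

theorem sum_law_mul_relayOutput (K : InputKernels S U R X₁ X₂ Y₂ Y₃) (F : S → U → R → ℝ) (y₂ : Y₂) :
    ∑ z, K.law z * (F (outS z) (outU z) (outR z) * ind (outY₂ z = y₂)) =
      ∑ s, ∑ u, ∑ r, K.Q.1 s * (K.pU s).1 u * (K.pR u s).1 r * F s u r *
        ∑ x₁, ∑ x₂, (K.p₁ u r s).1 x₁ * (K.p₂ u s).1 x₂ * relayOutput K.W x₁ x₂ s y₂ := by
  simp only [Fintype.sum_prod_type, law, relayOutput, Finset.mul_sum]
  refine Finset.sum_congr rfl fun s _ => Finset.sum_congr rfl fun u _ =>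
    Finset.sum_congr rfl fun r _ => Finset.sum_congr rfl fun x₁ _ =>
    Finset.sum_congr rfl fun x₂ _ => ?_
  rw [Finset.sum_eq_single y₂ (fun y _ hy => by simp [ind, hy]) (by simp)]
  refine Finset.sum_congr rfl fun y₃ _ => ?_
  rw [ind_of rfl]
  ring

/-- If the relay output depends on the source input only through the state and the relay input,
then nothing can be sent to the relay. -/
theorem exists_relayOutput_ne (K : InputKernels S U R X₁ X₂ Y₂ Y₃)
    (h : mutualInfo K.law outR (fun z => (outU z, outS z)) < mutualInfo K.law outR outY₂) :
    ∃ x₂ s x₁ x₁' y₂, K.Q.1 s ≠ 0 ∧ relayOutput K.W x₁ x₂ s y₂ ≠ relayOutput K.W x₁' x₂ s y₂ := by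
  by_contra! hne
  obtain ⟨s₀⟩ := nonempty_of_stdSimplex K.Q
  obtain ⟨u₀⟩ := nonempty_of_stdSimplex (K.pU s₀)
  obtain ⟨r₀⟩ := nonempty_of_stdSimplex (K.pR u₀ s₀)
  obtain ⟨x₀⟩ := nonempty_of_stdSimplex (K.p₁ u₀ r₀ s₀)
  refine absurd h (not_lt.2 (mutualInfo_le_of_factor K.law_nonneg K.sum_law outR
    (fun z => (outU z, outS z)) outY₂
    (fun r us => K.Q.1 us.2 * (K.pU us.2).1 us.1 * (K.pR us.1 us.2).1 r)
    (fun us y₂ => ∑ x₂, (K.p₂ us.1 us.2).1 x₂ * relayOutput K.W x₀ x₂ us.2 y₂) ?_))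
  rintro r ⟨u, s⟩ y₂
  rw [lawOf_eq_sum_ind]
  have := K.sum_law_mul_relayOutput (fun s' u' r' => ind (r' = r) * ind (u' = u) * ind (s' = s)) y₂
  simp only [Prod.mk.injEq, ind_and]
  simp only [← mul_assoc] at this ⊢
  rw [this]
  have hx : ∀ s' u' r', K.Q.1 s' * (∑ x₁, ∑ x₂, (K.p₁ u' r' s').1 x₁ * (K.p₂ u' s').1 x₂ *
      relayOutput K.W x₁ x₂ s' y₂) =
      K.Q.1 s' * ∑ x₂, (K.p₂ u' s').1 x₂ * relayOutput K.W x₀ x₂ s' y₂ := by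
    intro s' u' r'
    -- The assumption covers only states of positive probability, so the factor `Q` is kept on both
    -- sides.
    by_cases hs : K.Q.1 s' = 0
    · simp [hs]
    congr 1
    simp only [fun x₁ x₂ => hne x₂ s' x₁ x₀ y₂ hs, mul_assoc, ← Finset.mul_sum]
    rw [← Finset.sum_mul, (K.p₁ _ _ _).2.2, one_mul]
  have hterm : ∀ s' u' r', K.Q.1 s' * (K.pU s').1 u' * (K.pR u' s').1 r' * ind (r' = r) *
      ind (u' = u) * ind (s' = s) * (∑ x₁, ∑ x₂, (K.p₁ u' r' s').1 x₁ * (K.p₂ u' s').1 x₂ *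
      relayOutput K.W x₁ x₂ s' y₂) = K.Q.1 s' * (∑ x₂, (K.p₂ u' s').1 x₂ *
      relayOutput K.W x₀ x₂ s' y₂) * (K.pU s').1 u' * (K.pR u' s').1 r' * ind (r' = r) *
      ind (u' = u) * ind (s' = s) := by
    intro s' u' r'
    rw [← hx s' u' r']
    ring
  simp only [hterm, ← Finset.sum_mul, sum_mul_ind]
  ring

end InputKernels

theorem stdSimplex_eq_one {A : Type*} [Fintype A] [Subsingleton A] (p : stdSimplex ℝ A) (a : A) :
    p.1 a = 1 := by
  rw [← p.2.2, Fintype.sum_eq_single a fun b hb => absurd (Subsingleton.elim b a) hb]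

/-- If for some relay input the source can influence the relay output, then it can send information
to the relay at some positive rate. -/
theorem exists_start_code {S X₁ X₂ Y₂ Y₃ : Type*} [Fintype S] [Fintype X₁] [Fintype Y₂] [Fintype Y₃]
    (Q : stdSimplex ℝ S) (W : X₁ → X₂ → S → stdSimplex ℝ (Y₂ × Y₃))
    {x₂ : X₂} {s₀ : S} {x₁ x₁' : X₁} {y₂ : Y₂} (hs : Q.1 s₀ ≠ 0)
    (hne : relayOutput W x₁ x₂ s₀ y₂ ≠ relayOutput W x₁' x₂ s₀ y₂) :
    ∃ ρ : ℝ, 0 < ρ ∧ ∀ t : ℕ → ℕ, (∀ n, 1 ≤ t n) → (∀ n : ℕ, (t n : ℝ) ≤ 2 * 2 ^ ((n : ℝ) * ρ)) →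
      ∃ δ : ℕ → ℝ, Tendsto δ atTop (𝓝 0) ∧
        ∀ n, ∀ ν : stdSimplex ℝ (Fin (t n)), HasBlockCode Q W Unit Unit ν n (δ n) := by
  classical
  -- The two strategies differ only in state `s₀`. The choice between them is independent of the
  -- states, so it costs no information about them (`hzero`).
  let input : Bool → S → X₁ := fun r s => if r = true ∧ s = s₀ then x₁' else x₁
  let K : InputKernels S Unit Bool X₁ Unit Y₂ Y₃ :=
    { Q := Q
      W := fun x₁ _ s => W x₁ x₂ s
      pU := fun _ => pointSimplex ()
      pR := fun _ _ => uniformSimplex Bool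
      p₁ := fun _ r s => pointSimplex (input r s)
      p₂ := fun _ _ => pointSimplex () }
  have hR : ∀ r, lawOf K.law InputKernels.outR r = 1 / 2 := by
    intro r
    rw [lawOf_eq_sum_ind, K.sum_law_mul fun _ _ r' _ => ind (r' = r)]
    simp only [stdSimplex_eq_one, mul_one, Finset.univ_unique, Finset.sum_singleton, K,
      uniformSimplex, Fintype.card_bool, mul_assoc, ← Finset.mul_sum]
    rw [← Finset.sum_mul, Q.2.2]
    cases r <;> norm_num [ind]
  have hzero : mutualInfo K.law InputKernels.outR
      (fun z => (InputKernels.outU z, InputKernels.outS z)) = 0 := by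
    rw [mutualInfo_eq]
    refine Finset.sum_eq_zero fun z _ => ?_
    by_cases hz : K.law z = 0
    · simp [hz]
    have h5 := lawOf_pos K.law_nonneg (fun z => (InputKernels.outU z, InputKernels.outS z)) hz
    rw [hR, K.lawOf_relay_auxiliary_state, K.lawOf_auxiliary_state]
    rw [K.lawOf_auxiliary_state] at h5
    have : (K.pR (InputKernels.outU z) (InputKernels.outS z)).1 (InputKernels.outR z) = 1 / 2 := by
      simp [K, uniformSimplex]
    rw [this, mul_comm (1 / 2 : ℝ), div_self (mul_pos h5 (by norm_num)).ne', Real.logb_one, mul_zero]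
  -- the joint law of the input and output of the strategy channel
  let a : Bool → ℝ := fun r => ∑ s, Q.1 s * relayOutput W (input r s) x₂ s y₂
  have hRY : ∀ r, lawOf K.law (fun z => (InputKernels.outR z, InputKernels.outY₂ z)) (r, y₂) =
      1 / 2 * a r := by
    intro r
    simp only [lawOf_eq_sum_ind, Prod.mk.injEq, ind_and]
    rw [K.sum_law_mul_relayOutput (fun _ _ r' => ind (r' = r)) y₂]
    have hin : ∀ r' s, ∑ x, (pointSimplex (input r' s)).1 x * relayOutput W x x₂ s y₂ =
        relayOutput W (input r' s) x₂ s y₂ := fun r' s => by simp [pointSimplex, ind]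
    have hout : ∀ x s, relayOutput K.W x () s y₂ = relayOutput W x x₂ s y₂ := fun x s => rfl
    have hK : ∀ r' s, K.p₁ () r' s = pointSimplex (input r' s) := fun _ _ => rfl
    have hp : ∀ s r', (K.pR () s).1 r' = 1 / 2 := fun s r' => by simp [K, uniformSimplex]
    simp only [stdSimplex_eq_one, mul_one, Finset.univ_unique, Finset.sum_singleton,
      PUnit.default_eq_unit, hout, hK, hin, hp]
    simp only [a, Finset.mul_sum]
    refine Finset.sum_congr rfl fun s _ => ?_
    rw [Finset.sum_eq_single r (fun b _ hb => by rw [ind_of_not hb]; ring) (by simp), ind_of rfl]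
    change Q.1 s * _ * _ * _ = _
    ring
  have ha : a true ≠ a false := by
    have hd : a true - a false =
        Q.1 s₀ * (relayOutput W x₁' x₂ s₀ y₂ - relayOutput W x₁ x₂ s₀ y₂) := by
      simp only [a, ← Finset.sum_sub_distrib, ← mul_sub]
      rw [Finset.sum_eq_single s₀ (fun s _ hs => by simp [input, hs]) (by simp)]
      simp [input]
    intro h
    rw [h, sub_self] at hd
    exact (mul_ne_zero hs (sub_ne_zero.2 hne.symm)) hd.symm
  have ha0 : ∀ r, 0 ≤ a r := fun r => Finset.sum_nonneg fun s _ =>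
    mul_nonneg (Q.2.1 s) (Finset.sum_nonneg fun y _ => (W _ _ _).2.1 _)
  have hY : lawOf K.law InputKernels.outY₂ y₂ = 1 / 2 * a true + 1 / 2 * a false := by
    rw [← sum_lawOf_pair_left K.law InputKernels.outR, Fintype.sum_bool, hRY, hRY]
  have hpos : 0 < mutualInfo K.law InputKernels.outR InputKernels.outY₂ := by
    refine (mutualInfo_nonneg_and_pos K.law_nonneg K.sum_law _ _).2 ?_
    -- The strategy with the larger `a` has positive joint probability with `y₂`, and it exceeds the
    -- product of the marginals.
    rcases lt_or_gt_of_ne ha with h | h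
    · refine ⟨false, y₂, ?_, ?_⟩
      · rw [hRY]; linarith [ha0 true]
      · rw [hRY, hR, hY]; intro e; linarith
    · refine ⟨true, y₂, ?_, ?_⟩
      · rw [hRY]; linarith [ha0 false]
      · rw [hRY, hR, hY]; intro e; linarith
  set I := mutualInfo K.law InputKernels.outR InputKernels.outY₂ with hI
  refine ⟨I / 2, by linarith, fun t ht1 ht => ⟨_, K.tuned.tendsto_relay (m := fun n => (t n : ℝ))
    K.tuned_relay_pos (ρ := I / 2) ?_ (fun n => Nat.one_le_cast.2 (ht1 n)) ht, fun n ν => ?_⟩⟩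
  · have := K.sum_logb_relay
    rw [hzero, ← hI] at this
    change ∑ z, K.law z * _ + _ < 0
    refine lt_of_eq_of_lt (congrArg (· + I / 2) this) ?_
    linarith
  · obtain ⟨idx, rel, src, d₂, d₃, h⟩ := K.tuned.hasBlockCode (T := Unit) (M := Unit) ν n
    refine ⟨idx, fun _ _ => x₂, src, d₂, d₃, h.trans (le_of_eq ?_)⟩
    refine Finset.sum_congr rfl fun z _ => ?_
    obtain ⟨s, u, r, x, x', y⟩ := z
    -- With one-point alphabets for the destination's auxiliary variable and the relay input, only
    -- the relay term of the penalty survives.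
    simp [BlockKernels.penalty, stdSimplex_eq_one, mismatch_one_right]

end Start

/-! ### Block Markov coding and achievability. -/

section Achievability

variable {S X₁ X₂ Y₂ Y₃ : Type*} [Fintype S] [Fintype Y₂] [Fintype Y₃]

theorem RelayCode.errorProb_nonneg {M n : ℕ} (Q : stdSimplex ℝ S)
    (W : X₁ → X₂ → S → stdSimplex ℝ (Y₂ × Y₃)) (c : RelayCode S X₁ X₂ Y₂ Y₃ M n) :
    0 ≤ c.errorProb Q W := by
  refine Finset.sum_nonneg fun w _ => Finset.sum_nonneg fun s _ => Finset.sum_nonneg fun y₂ _ =>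
    Finset.sum_nonneg fun y₃ _ => ?_
  split_ifs
  · exact mul_nonneg (by positivity) (Finset.prod_nonneg fun i _ =>
      mul_nonneg (Q.2.1 _) ((W _ _ _).2.1 _))
  · exact le_rfl

/-- Codes within `1 / (n + 1)` of the infimum of the errors serve all lengths at once, so attainment
of the infimum is not needed. -/
theorem isAchievable_of_eventually [Nonempty X₁] [Nonempty X₂] {Q : stdSimplex ℝ S}
    {W : X₁ → X₂ → S → stdSimplex ℝ (Y₂ × Y₃)} {R : ℝ} (hR : 0 ≤ R)
    (h : ∀ ε : ℝ, 0 < ε → ∀ᶠ n : ℕ in atTop,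
      ∃ c : RelayCode S X₁ X₂ Y₂ Y₃ ⌈(2 : ℝ) ^ ((n : ℝ) * R)⌉₊ n, c.errorProb Q W ≤ ε) :
    IsAchievable Q W R := by
  obtain ⟨x₁⟩ := ‹Nonempty X₁›
  obtain ⟨x₂⟩ := ‹Nonempty X₂›
  let E : ∀ n : ℕ, RelayCode S X₁ X₂ Y₂ Y₃ ⌈(2 : ℝ) ^ ((n : ℝ) * R)⌉₊ n → ℝ :=
    fun n c => c.errorProb Q W
  have hb : ∀ n, BddBelow (Set.range (E n)) := fun n =>
    ⟨0, by rintro _ ⟨c, rfl⟩; exact c.errorProb_nonneg Q W⟩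
  have hne : ∀ n, (Set.range (E n)).Nonempty := fun n => by
    have : 0 < ⌈(2 : ℝ) ^ ((n : ℝ) * R)⌉₊ := Nat.ceil_pos.2 (Real.rpow_pos_of_pos two_pos _)
    exact ⟨_, ⟨⟨fun _ _ _ => x₁, fun _ _ => x₂, fun _ => ⟨0, this⟩⟩, rfl⟩⟩
  have h0 : ∀ n, 0 ≤ sInf (Set.range (E n)) := fun n =>
    le_csInf (hne n) (by rintro _ ⟨c, rfl⟩; exact c.errorProb_nonneg Q W)
  refine ⟨hR, fun n => sInf (Set.range (E n)) + 1 / ((n : ℝ) + 1), ?_, fun n => ?_⟩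
  · have h1 : Tendsto (fun n => sInf (Set.range (E n))) atTop (𝓝 0) := by
      rw [Metric.tendsto_atTop']
      intro ε hε
      obtain ⟨N, hN⟩ := eventually_atTop.1 (h (ε / 2) (by linarith))
      refine ⟨N, fun n hn => ?_⟩
      obtain ⟨c, hc⟩ := hN n hn.le
      have := csInf_le (hb n) ⟨c, rfl⟩
      rw [Real.dist_eq, sub_zero, abs_of_nonneg (h0 n)]
      exact this.trans_lt (hc.trans_lt (by linarith))
    simpa using h1.add tendsto_one_div_add_atTop_nhds_zero_nat
  · obtain ⟨_, ⟨c, rfl⟩, hc⟩ := exists_lt_of_csInf_lt (hne n)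
      (lt_add_of_pos_right (sInf (Set.range (E n))) (by positivity : 0 < 1 / ((n : ℝ) + 1)))
    exact ⟨c, hc.le⟩

theorem isAchievable_zero [Nonempty X₁] [Nonempty X₂] (Q : stdSimplex ℝ S)
    (W : X₁ → X₂ → S → stdSimplex ℝ (Y₂ × Y₃)) : IsAchievable Q W 0 := by
  obtain ⟨x₁⟩ := ‹Nonempty X₁›
  obtain ⟨x₂⟩ := ‹Nonempty X₂›
  refine isAchievable_of_eventually le_rfl fun ε hε => Eventually.of_forall fun n => ?_
  have h1 : ⌈(2 : ℝ) ^ ((n : ℝ) * 0)⌉₊ = 1 := by simp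
  rw [h1]
  refine ⟨⟨fun _ _ _ => x₁, fun _ _ => x₂, fun _ => 0⟩, ?_⟩
  refine le_trans (le_of_eq ?_) hε.le
  simp only [RelayCode.errorProb, ne_eq, Subsingleton.elim _ (0 : Fin 1), not_true, if_false,
    Finset.sum_const_zero]

/-- Repeated use of a block code that transmits the index needed in the next block. -/
theorem exists_indexedCode_repeat {Q : stdSimplex ℝ S} {W : X₁ → X₂ → S → stdSimplex ℝ (Y₂ × Y₃)}
    [Nonempty X₁] [Nonempty X₂] {T M : Type} [Fintype T] [Nonempty T] [Fintype M] [Nonempty M]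
    {m : ℕ} {ε : ℝ} (h : ∀ ν : stdSimplex ℝ T, HasBlockCode Q W T M ν m ε) (B k : ℕ) :
    ∃ (M' : Type) (_ : Fintype M') (_ : Nonempty M'), Fintype.card M' = Fintype.card M ^ B ∧
      HasIndexedCode Q W T M' (B * m + k) (B * ε) := by
  induction B with
  | zero =>
    refine ⟨Unit, inferInstance, inferInstance, by simp, ?_⟩
    simpa using hasIndexedCode_unit Q W T k
  | succ B ih =>
    obtain ⟨M', _, _, hM', hc⟩ := ih
    refine ⟨M × M', inferInstance, inferInstance, ?_, ?_⟩
    · rw [Fintype.card_prod, hM', pow_succ, mul_comm]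
    · have e1 : (B + 1) * m + k = m + (B * m + k) := by ring
      have e2 : ((B + 1 : ℕ) : ℝ) * ε = ε + B * ε := by push_cast; ring
      rw [e1, e2]
      exact hc.cons h

theorem ceil_two_rpow_le {x : ℝ} (hx : 0 ≤ x) : (⌈(2 : ℝ) ^ x⌉₊ : ℝ) ≤ 2 * 2 ^ x := by
  have := Nat.ceil_lt_add_one (Real.rpow_nonneg two_pos.le x)
  have := Real.one_le_rpow one_lt_two.le hx
  linarith

/-- Block Markov coding. -/
theorem isAchievable_of_blockCodes [Nonempty X₁] [Nonempty X₂] [Nonempty Y₂]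
    {Q : stdSimplex ℝ S} {W : X₁ → X₂ → S → stdSimplex ℝ (Y₂ × Y₃)} {R ρ σ ρ₀ : ℝ} (hR : 0 ≤ R)
    (hρ : R < ρ) (hσ : 0 ≤ σ) (hρ₀ : 0 < ρ₀) {δ : ℕ → ℝ} (hδ : Tendsto δ atTop (𝓝 0))
    (hblock : ∀ n : ℕ, ∀ ν : stdSimplex ℝ (Fin ⌈(2 : ℝ) ^ ((n : ℝ) * σ)⌉₊),
      HasBlockCode Q W (Fin ⌈(2 : ℝ) ^ ((n : ℝ) * σ)⌉₊) (Fin ⌈(2 : ℝ) ^ ((n : ℝ) * ρ)⌉₊) ν n (δ n))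
    (hstart : ∀ t : ℕ → ℕ, (∀ n, 1 ≤ t n) → (∀ n : ℕ, (t n : ℝ) ≤ 2 * 2 ^ ((n : ℝ) * ρ₀)) →
      ∃ δ : ℕ → ℝ, Tendsto δ atTop (𝓝 0) ∧
        ∀ n, ∀ ν : stdSimplex ℝ (Fin (t n)), HasBlockCode Q W Unit Unit ν n (δ n)) :
    IsAchievable Q W R := by
  have hceil : ∀ x : ℝ, 1 ≤ ⌈(2 : ℝ) ^ x⌉₊ := fun x =>
    Nat.one_le_ceil_iff.2 (Real.rpow_pos_of_pos two_pos _)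
  -- A starting phase of length `k₀ * m` at rate `ρ₀` can carry the `m * σ` bits of one index.
  obtain ⟨k₀, hk₀⟩ := exists_nat_gt (σ / ρ₀)
  rw [div_lt_iff₀ hρ₀] at hk₀
  have hk0 : 0 < k₀ := by
    rcases Nat.eq_zero_or_pos k₀ with h | h
    · rw [h, Nat.cast_zero, zero_mul] at hk₀
      linarith
    · exact h
  obtain ⟨δ₀, hδ₀, hstart⟩ := hstart (fun n => ⌈(2 : ℝ) ^ (((n / k₀ : ℕ) : ℝ) * σ)⌉₊)
    (fun n => hceil _) fun n => by
      refine (ceil_two_rpow_le (mul_nonneg (Nat.cast_nonneg _) hσ)).trans ?_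
      refine mul_le_mul_of_nonneg_left (Real.rpow_le_rpow_of_exponent_le one_lt_two.le ?_) two_pos.le
      have h1 : ((n / k₀ : ℕ) : ℝ) * k₀ ≤ n := by exact_mod_cast Nat.div_mul_le_self n k₀
      calc ((n / k₀ : ℕ) : ℝ) * σ ≤ ((n / k₀ : ℕ) : ℝ) * (k₀ * ρ₀) :=
            mul_le_mul_of_nonneg_left hk₀.le (Nat.cast_nonneg _)
        _ = ((n / k₀ : ℕ) : ℝ) * k₀ * ρ₀ := by ring
        _ ≤ n * ρ₀ := mul_le_mul_of_nonneg_right h1 hρ₀.le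
  -- With this `B`, the `B` informative blocks carry more than rate `R` over the total of `B + k₀`
  -- block lengths; `η` is the surplus per unit of `m`.
  obtain ⟨B, hB⟩ := exists_nat_gt (k₀ * R / (ρ - R))
  rw [div_lt_iff₀ (by linarith)] at hB
  set η := B * ρ - (B + k₀) * R with hη
  have hη0 : 0 < η := by rw [hη]; linarith
  set L := B + k₀ with hL
  have hLpos : 0 < L := by omega
  have hm : Tendsto (fun n : ℕ => n / L) atTop atTop := Nat.tendsto_div_const_atTop hLpos.ne'
  have hδ' : Tendsto (fun m : ℕ => δ₀ (k₀ * m) + B * δ m) atTop (𝓝 0) := by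
    have h1 : Tendsto (fun m : ℕ => k₀ * m) atTop atTop := tendsto_id.const_mul_atTop' hk0
    simpa using (hδ₀.comp h1).add (hδ.const_mul (B : ℝ))
  refine isAchievable_of_eventually hR fun ε hε => ?_
  -- From `m₀` on, the surplus `m * η` pays for the fewer than `L` leftover channel uses, which
  -- carry nothing.
  obtain ⟨m₀, hm₀⟩ := exists_nat_gt (L * R / η)
  filter_upwards [hm.eventually ((hδ'.eventually_lt_const hε).and (eventually_ge_atTop m₀))]
    with n ⟨hn1, hn2⟩
  set m := n / L with hmdef
  have hn : n = k₀ * m + (B * m + n % L) := by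
    have := Nat.div_add_mod n L
    rw [← hmdef, hL] at this
    rw [hL]
    nlinarith
  have : Nonempty (Fin ⌈(2 : ℝ) ^ ((m : ℝ) * σ)⌉₊) := ⟨⟨0, hceil _⟩⟩
  have : Nonempty (Fin ⌈(2 : ℝ) ^ ((m : ℝ) * ρ)⌉₊) := ⟨⟨0, hceil _⟩⟩
  obtain ⟨M', _, _, hM', hc⟩ := exists_indexedCode_repeat (hblock m) B (n % L)
  have hs := hstart (k₀ * m)
  rw [Nat.mul_div_cancel_left m hk0] at hs
  have hcode := hc.cons hs
  rw [← hn] at hcode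
  obtain ⟨c, hc⟩ := hcode.exists_relayCode (N := ⌈(2 : ℝ) ^ ((n : ℝ) * R)⌉₊) (hceil _) (by
    rw [Fintype.card_prod, Fintype.card_unit, one_mul, hM', Fintype.card_fin, Nat.ceil_le,
      Nat.cast_pow]
    have h1 : ((2 : ℝ) ^ ((m : ℝ) * ρ)) ^ B ≤ (⌈(2 : ℝ) ^ ((m : ℝ) * ρ)⌉₊ : ℝ) ^ B :=
      pow_le_pow_left₀ (Real.rpow_nonneg two_pos.le _) (Nat.le_ceil _) B
    refine le_trans ?_ h1
    rw [← Real.rpow_natCast, ← Real.rpow_mul two_pos.le]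
    refine Real.rpow_le_rpow_of_exponent_le one_lt_two.le ?_
    have h2 : (n : ℝ) ≤ L * (m + 1) := by
      have := (Nat.lt_mul_div_succ n hLpos).le
      rw [← hmdef] at this
      exact_mod_cast this
    have h3 : L * R ≤ m * η := by
      rw [div_lt_iff₀ hη0] at hm₀
      have : (m₀ : ℝ) ≤ m := Nat.cast_le.2 hn2
      nlinarith
    have h4 : (L : ℝ) = B + k₀ := by rw [hL]; push_cast; ring
    calc (n : ℝ) * R ≤ L * (m + 1) * R := mul_le_mul_of_nonneg_right h2 hR
      _ = m * (L * R) + L * R := by ring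
      _ ≤ m * (L * R) + m * η := by linarith
      _ = m * ρ * B := by rw [hη, h4]; ring)
  exact ⟨c, hc.trans hn1.le⟩

end Achievability

/-! ### Choice of the rates and conclusion. -/

theorem AnalogInput.isAchievable {S U UR X₁ X₂ X Y₂ Y₃ : Type*} [Fintype S] [Fintype U]
    [Fintype UR] [Fintype X₁] [Fintype X₂] [Fintype X] [Fintype Y₂] [Fintype Y₃]
    [Nonempty X₁] [Nonempty X₂] [Nonempty Y₂]
    {P : AnalogInput S U UR X₁ X₂ X} {Q : stdSimplex ℝ S}
    {W : X₁ → X₂ → S → stdSimplex ℝ (Y₂ × Y₃)} (hP : P.Feasible Q W) {R : ℝ} (hR : 0 ≤ R)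
    (hlt : R < P.rate Q W) : IsAchievable Q W R := by
  set K := P.kernels Q W with hK
  obtain ⟨ρ, hρ, hρ'⟩ := exists_between hlt
  have hfeas := hP.lt
  obtain ⟨σ, hσ, hσ'⟩ := exists_between hfeas
  have hσ1 := (P.description_le Q W).trans_lt hσ
  have hI := (mutualInfo_nonneg_and_pos K.law_nonneg K.sum_law InputKernels.outX₂
    fun z => (InputKernels.outU z, InputKernels.outS z)).1
  have hσ0 : 0 < σ := hI.trans_lt hσ1
  -- As `σ` is positive and below the information gap at the relay, the gap itself is positive.
  obtain ⟨x₂, s, x₁, x₁', y₂, hs, hne⟩ := K.exists_relayOutput_ne (by linarith)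
  obtain ⟨ρ₀, hρ₀, hstart⟩ := exists_start_code Q W hs hne
  have hceil : ∀ x : ℝ, 1 ≤ (⌈(2 : ℝ) ^ x⌉₊ : ℝ) := fun x =>
    Nat.one_le_cast.2 (Nat.one_le_ceil_iff.2 (Real.rpow_pos_of_pos two_pos _))
  rw [P.rate_eq Q W, ← hK] at hρ'
  have h3 := K.tuned.tendsto_destination (ρ := ρ) (m := fun n => ⌈(2 : ℝ) ^ ((n : ℝ) * ρ)⌉₊)
    K.tuned_destination_pos
    (lt_of_eq_of_lt (congrArg (· + ρ) K.sum_logb_destination) (by linarith))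
    (fun n => hceil _) fun n => ceil_two_rpow_le (mul_nonneg (Nat.cast_nonneg _) (hR.trans hρ.le))
  have h2 := K.tuned.tendsto_relay (ρ := σ) (m := fun n => ⌈(2 : ℝ) ^ ((n : ℝ) * σ)⌉₊)
    K.tuned_relay_pos
    (lt_of_eq_of_lt (congrArg (· + σ) K.sum_logb_relay) (by linarith))
    (fun n => hceil _) fun n => ceil_two_rpow_le (mul_nonneg (Nat.cast_nonneg _) hσ0.le)
  have hx := K.tuned.tendsto_description (ρ := σ) (t := fun n => ⌈(2 : ℝ) ^ ((n : ℝ) * σ)⌉₊)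
    K.tuned_input_pos (lt_of_eq_of_lt K.sum_logb_input hσ1) fun n => Nat.le_ceil _
  have hδ := (h3.add hx).add h2
  simp only [add_zero] at hδ
  refine isAchievable_of_blockCodes hR hρ hσ0.le hρ₀ hδ (fun n ν => ?_) hstart
  have : Nonempty (Fin ⌈(2 : ℝ) ^ ((n : ℝ) * σ)⌉₊) := ⟨⟨0, by exact_mod_cast hceil _⟩⟩
  have : Nonempty (Fin ⌈(2 : ℝ) ^ ((n : ℝ) * ρ)⌉₊) := ⟨⟨0, by exact_mod_cast hceil _⟩⟩
  obtain ⟨idx, rel, src, d₂, d₃, h⟩ := K.tuned.hasBlockCode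
    (T := Fin ⌈(2 : ℝ) ^ ((n : ℝ) * σ)⌉₊) (M := Fin ⌈(2 : ℝ) ^ ((n : ℝ) * ρ)⌉₊) ν n
  refine ⟨idx, rel, src, d₂, d₃, h.trans (le_of_eq ?_)⟩
  rw [← Finset.sum_add_distrib, ← Finset.sum_add_distrib]
  refine Finset.sum_congr rfl fun z _ => ?_
  rw [← mul_add, ← mul_add]
  simp only [BlockKernels.penalty, Fintype.card_fin]

theorem theorem2 {S X₁ X₂ Y₂ Y₃ : Type*} [Fintype S] [Fintype X₁] [Fintype X₂]
    [Fintype Y₂] [Fintype Y₃] (Q : stdSimplex ℝ S)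
    (W : X₁ → X₂ → S → stdSimplex ℝ (Y₂ × Y₃)) :
    analogInputRate Q W ≤ capacity Q W := by
  refine sSup_le ?_
  rintro r ⟨U, UR, X, _, _, _, P, hP, rfl⟩
  obtain ⟨s⟩ := nonempty_of_stdSimplex Q
  obtain ⟨u, ur⟩ := nonempty_of_stdSimplex (P.pU s)
  have h₁ : Nonempty X₁ := nonempty_of_stdSimplex (P.pX₁ u ur s)
  obtain ⟨x⟩ := nonempty_of_stdSimplex (P.pX u s)
  have h₂ : Nonempty X₂ := nonempty_of_stdSimplex (P.pXhat x)
  obtain ⟨y, -⟩ := nonempty_of_stdSimplex (W h₁.some h₂.some s)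
  have h₃ : Nonempty Y₂ := ⟨y⟩
  have hle : ∀ R : ℝ, IsAchievable Q W R → (R : EReal) ≤ capacity Q W := fun R h =>
    le_sSup ⟨R, h, rfl⟩
  by_contra! hlt
  obtain ⟨R, hR1, hR2⟩ := EReal.lt_iff_exists_real_btwn.1 hlt
  -- The rate of `P` may be negative; achievability of zero makes the intermediate `R` nonnegative.
  have h0 := hle 0 (isAchievable_zero Q W)
  have hR0 : 0 ≤ R := by exact_mod_cast h0.trans hR1.le
  exact absurd hR1 (not_lt.2 (hle R (AnalogInput.isAchievable hP hR0 (by exact_mod_cast hR2))))
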